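/- Fix $n\in\mathbb N$. An $\infty$-graph is a globular set $X$, i.e. a presheaf of sets on the globe category: sets $X_m$ ($m\in\mathbb N$) with iterated sources and targets $s^m_p,t^m_p:X_m\to X_p$ ($p<m$) satisfying the globular identities. Let $\infty\text{-}\mathbb{G}\mathrm{r}$ be the category of $\infty$-graphs and natural transformations. An $\infty$-magma is an $\infty$-graph $M$ with reflexors $1^p_m:M_p\to M_m$ ($p<m$) such that $1^q_m1^p_q=1^p_m$ and $s^m_p1^p_m=t^m_p1^p_m=\mathrm{id}$, and with composites $y\circ^m_p x\in M_m$ for $p<m$ and all $m$-cells $y,x$ with $s^m_p(y)=t^m_p(x)$, subject only to the positional axioms: for $p<q<m$, $s^m_q(y\circ^m_p x)=s^m_q(y)\circ^q_p s^m_q(x)$ and $t^m_q(y\circ^m_p x)=t^m_q(y)\circ^q_p t^m_q(x)$; for $q\le p<m$, $s^m_q(y\circ^m_p x)=s^m_q(x)$ and $t^m_q(y\circ^m_p x)=t^m_q(y)$. An $(\infty,n)$-magma is an $\infty$-magma with reversors $j^m_p:M_m\to M_m$ for $n\le p<m$ such that $s^{p+1}_p j^{p+1}_p=t^{p+1}_p$,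 $t^{p+1}_p j^{p+1}_p=s^{p+1}_p$, and, for $p<m$, $s^{m+1}_m j^{m+1}_p=j^m_p s^{m+1}_m$ and $t^{m+1}_m j^{m+1}_p=j^m_p t^{m+1}_m$. Morphisms are the maps of $\infty$-graphs preserving reflexors, composites and reversors. A strict $(\infty,n)$-category is a strict $\infty$-category (an $\infty$-magma whose composites are associative, unital for the reflexors and satisfy interchange, and whose reflexors preserve composites) in which, for all $n\le p<m$, every $m$-cell has a $\circ^m_p$-inverse; these inverses are unique, and taking them as reversors makes it an $(\infty,n)$-magma. An $(\infty,n)$-categorical stretching $(M,C,\pi,[-,-])$ consists of an $(\infty,n)$-magma $M$, a strict $(\infty,n)$-category $C$, a morphism of $(\infty,n)$-magmas $\pi:M\to C$, and, for each $m\in\mathbb N$, an operation assigning to every pair of parallel $m$-cells $c_1,c_0$ of $M$ (for $m\geq 1$: equal $(m-1)$-sources and equal $(m-1)$-targets; for $m=0$: no condition) with $\pi(c_1)=\pi(c_0)$ a cell $[c_1,c_0]_m\in M_{m+1}$ such that $t^{m+1}_m[c_1,c_0]_m=c_1$, $s^{m+1}_m[c_1,c_0]_m=c_0$, $\pi([c_1,c_0]_m)=1^m_{m+1}(\pi(c_1))$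 and $[c,c]_m=1^m_{m+1}(c)$. Morphisms $(M,C,\pi,[-,-])\to(M',C',\pi',[-,-])$ are pairs of morphisms of $(\infty,n)$-magmas $f:M\to M'$, $g:C\to C'$ with $\pi' f=g\pi$ and $f([c_1,c_0]_m)=[f(c_1),f(c_0)]_m$. Denote this category by $(\infty,n)\text{-}\mathbb{E}\mathrm{t}\mathbb{C}\mathrm{at}$. Theorem. For every $n\in\mathbb N$: (i) the category $(\infty,n)\text{-}\mathbb{E}\mathrm{t}\mathbb{C}\mathrm{at}$ is locally presentable; (ii) the forgetful functor $U_n:(\infty,n)\text{-}\mathbb{E}\mathrm{t}\mathbb{C}\mathrm{at}\to\infty\text{-}\mathbb{G}\mathrm{r}$, $(M,C,\pi,[-,-])\mapsto M$, has a left adjoint; (iii) for every left adjoint $F_n\dashv U_n$, the induced monad $\mathbb T^{(\infty,n)}$ on $\infty\text{-}\mathbb{G}\mathrm{r}$, with underlying functor $U_nF_n$, preserves (small) filtered colimits, and its category of algebras $\mathbb{A}\mathrm{lg}(\mathbb T^{(\infty,n)})$ (the weak $(\infty,n)$-categories) is locally presentable. -/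

import Mathlib

open CategoryTheory CategoryTheory.Limits Opposite

universe u

namespace InftyN

/-! ### The globe category and ∞-graphs -/

/-- Morphisms `p ⟶ m` of the globe category: the identity and, for `p < m`, the iterated cosource
`s` and the iterated cotarget `t`. These are the normal forms of the composites of the generators
`s, t : m ⟶ m + 1` modulo the coglobular relations (first `s`, then `s` or `t`, is the same; and
similarly for first `t`). -/
inductive GlobeHom : ℕ → ℕ → Type
  | id (m : ℕ) : GlobeHom m m
  | s {p m : ℕ} (h : p < m) : GlobeHom p m
  | t {p m : ℕ} (h : p < m) : GlobeHom p m

/-- Composition: the first non-identity morphism decides between cosource and cotarget. -/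
def GlobeHom.comp : {p q m : ℕ} → GlobeHom p q → GlobeHom q m → GlobeHom p m
  | _, _, _, .id _, g => g
  | _, _, _, .s h, .id _ => .s h
  | _, _, _, .s h, .s k => .s (h.trans k)
  | _, _, _, .s h, .t k => .s (h.trans k)
  | _, _, _, .t h, .id _ => .t h
  | _, _, _, .t h, .s k => .t (h.trans k)
  | _, _, _, .t h, .t k => .t (h.trans k)

theorem GlobeHom.comp_id {p m : ℕ} (f : GlobeHom p m) : f.comp (.id m) = f := by
  cases f <;> rfl

theorem GlobeHom.comp_assoc {p q m r : ℕ} (f : GlobeHom p q) (g : GlobeHom q m)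
    (h : GlobeHom m r) : (f.comp g).comp h = f.comp (g.comp h) := by
  cases f <;> cases g <;> cases h <;> rfl

/-- Objects of the globe category. -/
@[ext]
structure Globe where
  dim : ℕ

/-- The globe category. -/
instance : SmallCategory Globe where
  Hom a b := GlobeHom a.dim b.dim
  id a := .id a.dim
  comp f g := GlobeHom.comp f g
  id_comp _ := rfl
  comp_id f := GlobeHom.comp_id f
  assoc f g h := GlobeHom.comp_assoc f g h

/-- The cosource `p ⟶ m`. -/
def Globe.s {p m : ℕ} (h : p < m) : (⟨p⟩ : Globe) ⟶ ⟨m⟩ := GlobeHom.s h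

/-- The cotarget `p ⟶ m`. -/
def Globe.t {p m : ℕ} (h : p < m) : (⟨p⟩ : Globe) ⟶ ⟨m⟩ := GlobeHom.t h

/-- ∞-graphs (globular sets): presheaves of sets on the globe category. -/
abbrev InfGraph : Type (u + 1) := Globeᵒᵖ ⥤ Type u

namespace InfGraph

/-- The set of `m`-cells. -/
abbrev Cell (X : InfGraph.{u}) (m : ℕ) : Type u := X.obj (op ⟨m⟩)

variable {X Y : InfGraph.{u}}

/-- The iterated source `s^m_p : X_m → X_p`. -/
def src {p m : ℕ} (h : p < m) (x : X.Cell m) : X.Cell p := X.map (Globe.s h).op x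

/-- The iterated target `t^m_p : X_m → X_p`. -/
def tgt {p m : ℕ} (h : p < m) (x : X.Cell m) : X.Cell p := X.map (Globe.t h).op x

/-- The action of a morphism of ∞-graphs on `m`-cells. -/
abbrev mapCell (f : X ⟶ Y) {m : ℕ} (x : X.Cell m) : Y.Cell m := f.app (op ⟨m⟩) x

theorem src_src {p q m : ℕ} (h : p < q) (k : q < m) (x : X.Cell m) :
    src h (src k x) = src (h.trans k) x :=
  (Functor.map_comp_apply X (Globe.s k).op (Globe.s h).op x).symm

theorem src_tgt {p q m : ℕ} (h : p < q) (k : q < m) (x : X.Cell m) :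
    src h (tgt k x) = src (h.trans k) x :=
  (Functor.map_comp_apply X (Globe.t k).op (Globe.s h).op x).symm

theorem tgt_src {p q m : ℕ} (h : p < q) (k : q < m) (x : X.Cell m) :
    tgt h (src k x) = tgt (h.trans k) x :=
  (Functor.map_comp_apply X (Globe.s k).op (Globe.t h).op x).symm

theorem tgt_tgt {p q m : ℕ} (h : p < q) (k : q < m) (x : X.Cell m) :
    tgt h (tgt k x) = tgt (h.trans k) x :=
  (Functor.map_comp_apply X (Globe.t k).op (Globe.t h).op x).symm

theorem mapCell_src (f : X ⟶ Y) {p m : ℕ} (h : p < m) (x : X.Cell m) :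
    mapCell f (src h x) = src h (mapCell f x) :=
  NatTrans.naturality_apply f (Globe.s h).op x

theorem mapCell_tgt (f : X ⟶ Y) {p m : ℕ} (h : p < m) (x : X.Cell m) :
    mapCell f (tgt h x) = tgt h (mapCell f x) :=
  NatTrans.naturality_apply f (Globe.t h).op x

/-- Two `m`-cells are parallel if they have the same source and the same target in
dimension `m - 1`; two `0`-cells are always parallel. -/
def Parallel {m : ℕ} (c₁ c₀ : X.Cell m) : Prop :=
  ∀ (p : ℕ) (h : p + 1 = m),
    src (h ▸ p.lt_succ_self : p < m) c₁ = src (h ▸ p.lt_succ_self : p < m) c₀ ∧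
    tgt (h ▸ p.lt_succ_self : p < m) c₁ = tgt (h ▸ p.lt_succ_self : p < m) c₀

theorem Parallel.map (f : X ⟶ Y) {m : ℕ} {c₁ c₀ : X.Cell m} (h : Parallel c₁ c₀) :
    Parallel (mapCell f c₁) (mapCell f c₀) := fun p hp => by
  obtain ⟨h₁, h₂⟩ := h p hp
  exact ⟨by rw [← mapCell_src, h₁, mapCell_src], by rw [← mapCell_tgt, h₂, mapCell_tgt]⟩

end InfGraph

open InfGraph

/-! ### ∞-magmas -/

/-- An ∞-magma: a reflexive ∞-graph (reflexors `1^p_m`) with compositions `∘^m_p` which satisfy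
only the positional axioms. The composite `y ∘^m_p x` is defined when `s^m_p y = t^m_p x`. -/
structure InfMagma : Type (u + 1) where
  graph : InfGraph.{u}
  one {p m : ℕ} (h : p < m) : graph.Cell p → graph.Cell m
  one_one {p q m : ℕ} (h : p < q) (k : q < m) (x : graph.Cell p) :
    one k (one h x) = one (h.trans k) x
  src_one {p m : ℕ} (h : p < m) (x : graph.Cell p) : src h (one h x) = x
  tgt_one {p m : ℕ} (h : p < m) (x : graph.Cell p) : tgt h (one h x) = x
  comp {p m : ℕ} (h : p < m) (y x : graph.Cell m) (hyx : src h y = tgt h x) : graph.Cell m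
  src_comp_of_lt {p q m : ℕ} (h : p < q) (k : q < m) (y x : graph.Cell m)
    (hyx : src (h.trans k) y = tgt (h.trans k) x) :
    src k (comp (h.trans k) y x hyx) =
      comp h (src k y) (src k x) (by rw [src_src, tgt_src, hyx])
  tgt_comp_of_lt {p q m : ℕ} (h : p < q) (k : q < m) (y x : graph.Cell m)
    (hyx : src (h.trans k) y = tgt (h.trans k) x) :
    tgt k (comp (h.trans k) y x hyx) =
      comp h (tgt k y) (tgt k x) (by rw [src_tgt, tgt_tgt, hyx])
  src_comp_of_le {q p m : ℕ} (h : q ≤ p) (k : p < m) (y x : graph.Cell m)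
    (hyx : src k y = tgt k x) :
    src (h.trans_lt k) (comp k y x hyx) = src (h.trans_lt k) x
  tgt_comp_of_le {q p m : ℕ} (h : q ≤ p) (k : p < m) (y x : graph.Cell m)
    (hyx : src k y = tgt k x) :
    tgt (h.trans_lt k) (comp k y x hyx) = tgt (h.trans_lt k) y

namespace InfMagma

variable (M : InfMagma.{u})

theorem src_one_of_lt {p q m : ℕ} (h : p < q) (k : q < m) (x : M.graph.Cell p) :
    src k (M.one (h.trans k) x) = M.one h x := by
  rw [← M.one_one h k, M.src_one]

theorem tgt_one_of_lt {p q m : ℕ} (h : p < q) (k : q < m) (x : M.graph.Cell p) :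
    tgt k (M.one (h.trans k) x) = M.one h x := by
  rw [← M.one_one h k, M.tgt_one]

theorem src_one_of_gt {q p m : ℕ} (h : q < p) (k : p < m) (x : M.graph.Cell p) :
    src (h.trans k) (M.one k x) = src h x := by
  rw [← src_src h k, M.src_one]

theorem tgt_one_of_gt {q p m : ℕ} (h : q < p) (k : p < m) (x : M.graph.Cell p) :
    tgt (h.trans k) (M.one k x) = tgt h x := by
  rw [← tgt_tgt h k, M.tgt_one]

theorem comp_congr {p m : ℕ} (h : p < m) {y y' x x' : M.graph.Cell m}
    (hy : y = y') (hx : x = x') (hyx : src h y = tgt h x) :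
    M.comp h y x hyx = M.comp h y' x' (by rw [← hy, ← hx, hyx]) := by
  subst hy hx; rfl

/-- `β` is a `∘^m_p`-inverse of `α`: the two composites are defined and are identities. -/
def IsInverse {p m : ℕ} (h : p < m) (α β : M.graph.Cell m) : Prop :=
  ∃ (e₁ : src h α = tgt h β) (e₂ : src h β = tgt h α),
    M.comp h α β e₁ = M.one h (tgt h α) ∧ M.comp h β α e₂ = M.one h (src h α)

end InfMagma

/-- A morphism of ∞-magmas: a morphism of ∞-graphs that preserves reflexors and compositions. -/
structure IsInfMagmaHom (M N : InfMagma.{u}) (f : M.graph ⟶ N.graph) : Prop where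
  map_one {p m : ℕ} (h : p < m) (x : M.graph.Cell p) :
    mapCell f (M.one h x) = N.one h (mapCell f x)
  map_comp {p m : ℕ} (h : p < m) (y x : M.graph.Cell m) (hyx : src h y = tgt h x) :
    mapCell f (M.comp h y x hyx) =
      N.comp h (mapCell f y) (mapCell f x) (by rw [← mapCell_src, hyx, mapCell_tgt])

/-! ### Strict ∞-categories and strict (∞,n)-categories -/

/-- A strict ∞-category: an ∞-magma satisfying associativity, the unit laws, the interchange law
and the functoriality of the reflexors. -/
structure StrictInfCat : Type (u + 1) extends InfMagma.{u} where
  assoc {p m : ℕ} (h : p < m) (z y x : graph.Cell m)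
    (hzy : src h z = tgt h y) (hyx : src h y = tgt h x) :
    comp h (comp h z y hzy) x ((src_comp_of_le le_rfl h z y hzy).trans hyx) =
      comp h z (comp h y x hyx) (hzy.trans (tgt_comp_of_le le_rfl h y x hyx).symm)
  one_comp {p m : ℕ} (h : p < m) (x : graph.Cell m) :
    comp h (one h (tgt h x)) x (src_one h _) = x
  comp_one {p m : ℕ} (h : p < m) (y : graph.Cell m) :
    comp h y (one h (src h y)) (tgt_one h _).symm = y
  interchange {p q m : ℕ} (h : p < q) (k : q < m) (y' y x' x : graph.Cell m)
    (hy : src k y' = tgt k y) (hx : src k x' = tgt k x)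
    (hyx' : src (h.trans k) y' = tgt (h.trans k) x')
    (hyx : src (h.trans k) y = tgt (h.trans k) x) :
    comp (h.trans k) (comp k y' y hy) (comp k x' x hx)
        (by rw [src_comp_of_le h.le k, tgt_comp_of_le h.le k, hyx,
              ← tgt_tgt h k x, ← hx, tgt_src]) =
      comp k (comp (h.trans k) y' x' hyx') (comp (h.trans k) y x hyx)
        (by rw [src_comp_of_lt h k, tgt_comp_of_lt h k]
            exact toInfMagma.comp_congr h hy hx _)
  one_map_comp {q p m : ℕ} (h : q < p) (k : p < m) (y x : graph.Cell p)
    (hyx : src h y = tgt h x) :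
    one k (comp h y x hyx) =
      comp (h.trans k) (one k y) (one k x)
        (by rw [toInfMagma.src_one_of_gt h k, toInfMagma.tgt_one_of_gt h k, hyx])

namespace StrictInfCat

variable (C : StrictInfCat.{u})

theorem inverse_unique {p m : ℕ} (h : p < m) {α β β' : C.graph.Cell m}
    (hβ : C.IsInverse h α β) (hβ' : C.IsInverse h α β') : β = β' := by
  obtain ⟨e₁, e₂, -, hβα⟩ := hβ
  obtain ⟨e₁', e₂', hαβ', -⟩ := hβ'
  calc β = C.comp h β (C.one h (src h β)) (C.tgt_one h _).symm := (C.comp_one h β).symm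
    _ = C.comp h β (C.comp h α β' e₁') (e₂.trans (C.tgt_comp_of_le le_rfl h α β' e₁').symm) :=
        C.comp_congr h rfl (by rw [hαβ', e₂]) _
    _ = C.comp h (C.comp h β α e₂) β' ((C.src_comp_of_le le_rfl h β α e₂).trans e₁') :=
        (C.assoc h β α β' e₂ e₁').symm
    _ = C.comp h (C.one h (tgt h β')) β' (C.src_one h _) :=
        C.comp_congr h (by rw [hβα, e₁']) rfl _
    _ = β' := C.one_comp h β'

theorem isInverse_src {p q m : ℕ} (h : p < q) (k : q < m) {α β : C.graph.Cell m}
    (hβ : C.IsInverse (h.trans k) α β) : C.IsInverse h (src k α) (src k β) := by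
  obtain ⟨e₁, e₂, h₁, h₂⟩ := hβ
  refine ⟨by rw [src_src, tgt_src, e₁], by rw [src_src, tgt_src, e₂], ?_, ?_⟩
  · rw [← C.src_comp_of_lt h k _ _ (by assumption), h₁, C.src_one_of_lt h k, tgt_src]
  · rw [← C.src_comp_of_lt h k _ _ (by assumption), h₂, C.src_one_of_lt h k, src_src]

theorem isInverse_tgt {p q m : ℕ} (h : p < q) (k : q < m) {α β : C.graph.Cell m}
    (hβ : C.IsInverse (h.trans k) α β) : C.IsInverse h (tgt k α) (tgt k β) := by
  obtain ⟨e₁, e₂, h₁, h₂⟩ := hβ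
  refine ⟨by rw [src_tgt, tgt_tgt, e₁], by rw [src_tgt, tgt_tgt, e₂], ?_, ?_⟩
  · rw [← C.tgt_comp_of_lt h k _ _ (by assumption), h₁, C.tgt_one_of_lt h k, tgt_tgt]
  · rw [← C.tgt_comp_of_lt h k _ _ (by assumption), h₂, C.tgt_one_of_lt h k, src_tgt]

end StrictInfCat

/-- A strict (∞,n)-category: a strict ∞-category in which, for all `n ≤ p < m`, every `m`-cell has
a `∘^m_p`-inverse. -/
structure StrictNCat (n : ℕ) : Type (u + 1) extends StrictInfCat.{u} where
  exists_inverse {p m : ℕ} (hn : n ≤ p) (h : p < m) (α : graph.Cell m) :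
    ∃ β, toInfMagma.IsInverse h α β

/-! ### (∞,n)-magmas -/

/-- An (∞,n)-magma: an ∞-magma with an (∞,n)-reversible structure, that is, with reversors
`j^m_p : M_m → M_m` for `n ≤ p < m`. The reversor `j^{p+1}_p` exchanges source and target, and
`j^{m+1}_p` lies over `j^m_p` for `p < m`. -/
structure NMagma (n : ℕ) : Type (u + 1) extends InfMagma.{u} where
  rev {p m : ℕ} (hn : n ≤ p) (h : p < m) : graph.Cell m → graph.Cell m
  src_rev_succ {p : ℕ} (hn : n ≤ p) (x : graph.Cell (p + 1)) :
    src p.lt_succ_self (rev hn p.lt_succ_self x) = tgt p.lt_succ_self x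
  tgt_rev_succ {p : ℕ} (hn : n ≤ p) (x : graph.Cell (p + 1)) :
    tgt p.lt_succ_self (rev hn p.lt_succ_self x) = src p.lt_succ_self x
  src_rev {p m : ℕ} (hn : n ≤ p) (h : p < m) (x : graph.Cell (m + 1)) :
    src m.lt_succ_self (rev hn (h.trans m.lt_succ_self) x) = rev hn h (src m.lt_succ_self x)
  tgt_rev {p m : ℕ} (hn : n ≤ p) (h : p < m) (x : graph.Cell (m + 1)) :
    tgt m.lt_succ_self (rev hn (h.trans m.lt_succ_self) x) = rev hn h (tgt m.lt_succ_self x)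

/-- A morphism of (∞,n)-magmas: a morphism of ∞-magmas that preserves the reversors. -/
@[ext]
structure NMagma.Hom {n : ℕ} (M N : NMagma.{u} n) : Type u where
  graphHom : M.graph ⟶ N.graph
  isInfMagmaHom : IsInfMagmaHom M.toInfMagma N.toInfMagma graphHom
  map_rev {p m : ℕ} (hn : n ≤ p) (h : p < m) (x : M.graph.Cell m) :
    mapCell graphHom (M.rev hn h x) = N.rev hn h (mapCell graphHom x)

/-- The category of (∞,n)-magmas. -/
instance (n : ℕ) : Category.{u} (NMagma.{u} n) where
  Hom := NMagma.Hom
  id M :=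
    { graphHom := 𝟙 M.graph
      isInfMagmaHom := ⟨fun _ _ => rfl, fun _ _ _ _ => rfl⟩
      map_rev := fun _ _ _ => rfl }
  comp {M N P} f g :=
    { graphHom := f.graphHom ≫ g.graphHom
      isInfMagmaHom :=
        ⟨fun h x => (congrArg (mapCell g.graphHom) (f.isInfMagmaHom.map_one h x)).trans
            (g.isInfMagmaHom.map_one h _),
          fun h y x e => (congrArg (mapCell g.graphHom) (f.isInfMagmaHom.map_comp h y x e)).trans
            (g.isInfMagmaHom.map_comp h _ _ _)⟩
      map_rev := fun hn h x => (congrArg (mapCell g.graphHom) (f.map_rev hn h x)).trans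
        (g.map_rev hn h _) }

/-- The canonical reversors of a strict (∞,n)-category: `j^m_p α` is the unique
`∘^m_p`-inverse of `α`. -/
noncomputable def StrictNCat.rev {n : ℕ} (C : StrictNCat.{u} n) {p m : ℕ} (hn : n ≤ p) (h : p < m)
    (α : C.graph.Cell m) : C.graph.Cell m :=
  (C.exists_inverse hn h α).choose

theorem StrictNCat.isInverse_rev {n : ℕ} (C : StrictNCat.{u} n) {p m : ℕ} (hn : n ≤ p) (h : p < m)
    (α : C.graph.Cell m) : C.IsInverse h α (C.rev hn h α) :=
  (C.exists_inverse hn h α).choose_spec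

/-- The (∞,n)-magma underlying a strict (∞,n)-category. -/
noncomputable def StrictNCat.toNMagma {n : ℕ} (C : StrictNCat.{u} n) : NMagma.{u} n where
  toInfMagma := C.toInfMagma
  rev := C.rev
  src_rev_succ hn x := (C.isInverse_rev hn _ x).choose_spec.choose
  tgt_rev_succ hn x := (C.isInverse_rev hn _ x).choose.symm
  src_rev {_ m} hn h x :=
    C.inverse_unique h (C.isInverse_src h m.lt_succ_self
      (C.isInverse_rev hn _ x)) (C.isInverse_rev hn h _)
  tgt_rev {_ m} hn h x :=
    C.inverse_unique h (C.isInverse_tgt h m.lt_succ_self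
      (C.isInverse_rev hn _ x)) (C.isInverse_rev hn h _)

/-! ### (∞,n)-categorical stretchings -/

/-- An (∞,n)-categorical stretching `(M, C, π, [-,-])`. The bracket `[c₁, c₀]_m` is defined for
parallel `m`-cells `c₁, c₀` of `M` with `π c₁ = π c₀`. -/
structure Stretching (n : ℕ) : Type (u + 1) where
  M : NMagma.{u} n
  C : StrictNCat.{u} n
  π : M ⟶ C.toNMagma
  bracket {m : ℕ} (c₁ c₀ : M.graph.Cell m) (hpar : Parallel c₁ c₀)
    (hπ : mapCell π.graphHom c₁ = mapCell π.graphHom c₀) : M.graph.Cell (m + 1)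
  tgt_bracket {m : ℕ} (c₁ c₀ : M.graph.Cell m) (hpar : Parallel c₁ c₀)
    (hπ : mapCell π.graphHom c₁ = mapCell π.graphHom c₀) :
    tgt m.lt_succ_self (bracket c₁ c₀ hpar hπ) = c₁
  src_bracket {m : ℕ} (c₁ c₀ : M.graph.Cell m) (hpar : Parallel c₁ c₀)
    (hπ : mapCell π.graphHom c₁ = mapCell π.graphHom c₀) :
    src m.lt_succ_self (bracket c₁ c₀ hpar hπ) = c₀
  π_bracket {m : ℕ} (c₁ c₀ : M.graph.Cell m) (hpar : Parallel c₁ c₀)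
    (hπ : mapCell π.graphHom c₁ = mapCell π.graphHom c₀) :
    mapCell π.graphHom (bracket c₁ c₀ hpar hπ) = C.one m.lt_succ_self (mapCell π.graphHom c₁)
  bracket_self {m : ℕ} (c : M.graph.Cell m) (hpar : Parallel c c)
    (hπ : mapCell π.graphHom c = mapCell π.graphHom c) :
    bracket c c hpar hπ = M.one m.lt_succ_self c

namespace Stretching

variable {n : ℕ}

theorem π_map_eq {E F : Stretching.{u} n} {f : E.M ⟶ F.M} {g : E.C.toNMagma ⟶ F.C.toNMagma}
    (w : f ≫ F.π = E.π ≫ g) {m : ℕ} {c₁ c₀ : E.M.graph.Cell m}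
    (h : mapCell E.π.graphHom c₁ = mapCell E.π.graphHom c₀) :
    mapCell F.π.graphHom (mapCell f.graphHom c₁) =
      mapCell F.π.graphHom (mapCell f.graphHom c₀) := by
  have key : ∀ c : E.M.graph.Cell m, mapCell F.π.graphHom (mapCell f.graphHom c) =
      mapCell g.graphHom (mapCell E.π.graphHom c) := fun c =>
    congrArg (fun k : E.M ⟶ F.C.toNMagma => mapCell k.graphHom c) w
  rw [key, key, h]

/-- A morphism of stretchings: a commutative square of (∞,n)-magmas that preserves brackets. -/
@[ext]
structure Hom (E F : Stretching.{u} n) : Type u where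
  magmaHom : E.M ⟶ F.M
  catHom : E.C.toNMagma ⟶ F.C.toNMagma
  w : magmaHom ≫ F.π = E.π ≫ catHom
  map_bracket {m : ℕ} (c₁ c₀ : E.M.graph.Cell m) (hpar : Parallel c₁ c₀)
    (hπ : mapCell E.π.graphHom c₁ = mapCell E.π.graphHom c₀) :
    mapCell magmaHom.graphHom (E.bracket c₁ c₀ hpar hπ) =
      F.bracket (mapCell magmaHom.graphHom c₁) (mapCell magmaHom.graphHom c₀)
        (hpar.map magmaHom.graphHom) (π_map_eq w hπ)

/-- The category of (∞,n)-categorical stretchings. -/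
noncomputable instance : Category.{u} (Stretching.{u} n) where
  Hom := Hom
  id E :=
    { magmaHom := 𝟙 E.M
      catHom := 𝟙 _
      w := by rw [Category.id_comp, Category.comp_id]
      map_bracket := fun _ _ _ _ => rfl }
  comp {E F G} f g :=
    { magmaHom := f.magmaHom ≫ g.magmaHom
      catHom := f.catHom ≫ g.catHom
      w := by rw [Category.assoc, g.w, ← Category.assoc, f.w, Category.assoc]
      map_bracket := fun c₁ c₀ hpar hπ =>
        (congrArg (mapCell g.magmaHom.graphHom) (f.map_bracket c₁ c₀ hpar hπ)).trans
          (g.map_bracket _ _ _ _) }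

end Stretching

/-- The forgetful functor `U_n : (M, C, π, [-,-]) ↦ M` from (∞,n)-categorical stretchings to
∞-graphs. -/
noncomputable def stretchingForget (n : ℕ) : Stretching.{u} n ⥤ InfGraph.{u} where
  obj E := E.M.graph
  map f := f.magmaHom.graphHom
  map_id _ := rfl
  map_comp _ _ := rfl

end InftyN

-- All three assertions rest on one principle. In a locally finitely presentable category, take a
-- small family of natural transformations `α i : Φ i ⟶ Ψ i` between set-valued functors
-- corepresented by finitely presentable objects. By Yoneda, bijectivity of every `α i` at `X` says
-- that `X` is orthogonal to a small set of morphisms between finitely presentable objects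
-- (`bijectiveObjects_eq_isLocal`). Such objects form a locally finitely presentable reflective
-- subcategory whose inclusion preserves filtered colimits.
--
-- Stretchings: each partial operation becomes a sort of its own, with maps to its arguments and its
-- value. A stretching then has a nerve, a set-valued functor on the category `Shape n`, and the
-- nerve functor is fully faithful because an element of an operation is determined by its
-- arguments. The axioms become sequents of the form "equations imply unique existence", and
-- validity of a sequent is bijectivity of a map between finite limits of evaluations
-- (`Sequent.holds_iff`). Instead of a list of axioms, the theory consists of all sequents valid in
-- the nerves of all stretchings. Each axiom then passes to every model by checking it in
-- stretchings (`Model.horn`, `Model.existsUnique`), so every model is isomorphic to the nerve of a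
-- stretching. Hence stretchings form a locally finitely presentable category, and the forgetful
-- functor, being an equivalence followed by a reflective inclusion and a restriction of presheaves,
-- is a right adjoint and preserves filtered colimits.
--
-- Algebras: let `T` be a monad preserving filtered colimits on the presheaves on `G`, and let `J`
-- be a small model of the finitely presentable presheaves. An algebra is determined by the maps
-- into it from the free algebras on objects of `J`, that is, by a presheaf on a small Kleisli
-- category. Such a presheaf `P` comes from an algebra exactly if, for every `X` in `J`, its value
-- at `X` is the set of maps from `X` to the restriction of `P` to `G`
-- (`FreeIndex.essImage_nerve_eq`). This is again a bijectivity condition between finitely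
-- corepresentable functors, so the same principle applies (`isCardinalLocallyPresentable_algebra`).

attribute [local instance] Cardinal.fact_isRegular_aleph0

/-! ### Orthogonality classes cut out by finitely corepresentable functors -/

namespace CategoryTheory

universe v' u' u₁

/-- A functor to types is finitely corepresentable if it is corepresented by a finitely
presentable object. -/
def IsFinitelyCorepresentable {C : Type u₁} [Category.{u} C] (Φ : C ⥤ Type u) : Prop :=
  ∃ A : C, IsFinitelyPresentable.{u} A ∧ Nonempty (Φ.CorepresentableBy A)

namespace IsFinitelyCorepresentable

variable {C : Type u₁} [Category.{u} C]

/-- An element of `Φ X` is a map from the point to `Φ X`, hence a map `L pt ⟶ X` for the left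
adjoint `L`. The point is finitely presentable, and the left adjoint of a functor preserving
filtered colimits preserves finite presentability. -/
theorem of_isRightAdjoint (Φ : C ⥤ Type u) [Φ.IsRightAdjoint]
    [Φ.IsCardinalAccessible Cardinal.aleph0.{u}] : IsFinitelyCorepresentable Φ := by
  let adj := Adjunction.ofIsRightAdjoint Φ
  have hP : IsFinitelyPresentable.{u} (PUnit.{u + 1} : Type u) := by
    rw [IsFinitelyPresentable, Types.isCardinalPresentable_iff]
    exact hasCardinalLT_of_finite _ _ le_rfl
  refine ⟨Φ.leftAdjoint.obj PUnit, adj.isCardinalPresentable_leftAdjoint_obj _ _, ⟨?_⟩⟩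
  exact
    { homEquiv := fun {Y} => (adj.homEquiv _ _).trans
        ⟨fun f => f PUnit.unit, fun y => ↾fun _ => y, fun _ => rfl, fun _ => rfl⟩
      homEquiv_comp := fun g f => by
        simp [Adjunction.homEquiv_naturality_right] }

theorem comp_coyoneda {D : Type u'} [Category.{u} D] (G : C ⥤ D) [G.IsRightAdjoint]
    [G.IsCardinalAccessible Cardinal.aleph0.{u}] (X : D) [IsFinitelyPresentable.{u} X] :
    IsFinitelyCorepresentable (G ⋙ coyoneda.obj (op X)) := by
  let adj := Adjunction.ofIsRightAdjoint G
  exact ⟨G.leftAdjoint.obj X, adj.isCardinalPresentable_leftAdjoint_obj _ _,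
    ⟨{ homEquiv := adj.homEquiv _ _
       homEquiv_comp := fun g f => adj.homEquiv_naturality_right f g }⟩⟩

end IsFinitelyCorepresentable

/-- The objects at which every member of a family of natural transformations between functors to
types is bijective. -/
def bijectiveObjects {C : Type u₁} [Category.{u} C] {I : Type u'} {Φ Ψ : I → C ⥤ Type u}
    (α : ∀ i, Φ i ⟶ Ψ i) : ObjectProperty C :=
  fun X => ∀ i, Function.Bijective ((α i).app X)

section

variable {C : Type u₁} [Category.{u} C] {I : Type u'} [Small.{u} I] {Φ Ψ : I → C ⥤ Type u}
  (α : ∀ i, Φ i ⟶ Ψ i) (hΦ : ∀ i, IsFinitelyCorepresentable (Φ i))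
  (hΨ : ∀ i, IsFinitelyCorepresentable (Ψ i))

include hΦ hΨ

/-- By Yoneda, each transformation is precomposition with a morphism `w i : B i ⟶ A i` between the
corepresenting objects, so its bijectivity at `X` is locality of `X` with respect to `w i`. -/
theorem bijectiveObjects_eq_isLocal :
    ∃ (W : MorphismProperty C) (_ : MorphismProperty.IsSmall.{u} W),
      (∀ ⦃X Y : C⦄ (f : X ⟶ Y), W f →
        IsFinitelyPresentable.{u} X ∧ IsFinitelyPresentable.{u} Y) ∧
      bijectiveObjects α = W.isLocal := by
  choose A hA eA using hΦ
  choose B hB eB using hΨ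
  replace eA := fun i => (eA i).some
  replace eB := fun i => (eB i).some
  -- The image under `α i` of the universal element of `Φ i`, read as a morphism out of `B i`.
  let w : ∀ i, B i ⟶ A i := fun i =>
    (eB i).homEquiv.symm ((α i).app _ ((eA i).homEquiv (𝟙 _)))
  have hw : ∀ i (X : C), (fun g : A i ⟶ X => w i ≫ g) =
      (eB i).homEquiv.symm ∘ (α i).app X ∘ (eA i).homEquiv := fun i X => by
    funext g
    apply (eB i).homEquiv.injective
    rw [(eB i).homEquiv_comp]
    simp only [w, Equiv.apply_symm_apply, Function.comp_apply]
    rw [(eA i).homEquiv_eq g, NatTrans.naturality_apply]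
  refine ⟨MorphismProperty.ofHoms w, inferInstance, ?_, ?_⟩
  · rintro _ _ _ ⟨i⟩
    exact ⟨hB i, hA i⟩
  · ext X
    refine ⟨fun h => ?_, fun h i => ?_⟩
    · rintro _ _ _ ⟨i⟩
      rw [hw]
      exact (eB i).homEquiv.symm.bijective.comp ((h i).comp (eA i).homEquiv.bijective)
    · have := h _ (MorphismProperty.ofHoms.mk (f := w) i)
      rw [hw] at this
      have h2 := (eB i).homEquiv.bijective.comp (this.comp (eA i).homEquiv.symm.bijective)
      convert h2
      ext x
      simp

theorem isCardinalLocallyPresentable_bijectiveObjects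
    [IsCardinalLocallyPresentable C Cardinal.aleph0.{u}] :
    IsCardinalLocallyPresentable (bijectiveObjects α).FullSubcategory Cardinal.aleph0.{u} := by
  obtain ⟨W, _, hW, h⟩ := bijectiveObjects_eq_isLocal α hΦ hΨ
  rw [h]
  exact W.isLocallyPresentable_isLocal _ hW

theorem isRightAdjoint_bijectiveObjects_ι
    [IsCardinalLocallyPresentable C Cardinal.aleph0.{u}] :
    (bijectiveObjects α).ι.IsRightAdjoint := by
  obtain ⟨W, _, hW, h⟩ := bijectiveObjects_eq_isLocal α hΦ hΨ
  rw [h]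
  exact W.isRightAdjoint_ι_isLocal _ hW

theorem isCardinalAccessible_bijectiveObjects_ι
    [IsCardinalLocallyPresentable C Cardinal.aleph0.{u}] :
    (bijectiveObjects α).ι.IsCardinalAccessible Cardinal.aleph0.{u} := by
  obtain ⟨W, _, hW, h⟩ := bijectiveObjects_eq_isLocal α hΦ hΨ
  rw [h]
  exact W.isCardinalAccessible_ι_isLocal _ hW

end

/-- Functors from a small category to types form a locally finitely presentable category. -/
instance isCardinalLocallyPresentable_functor_type {D : Type} [SmallCategory D] :
    IsCardinalLocallyPresentable (D ⥤ Type u) Cardinal.aleph0.{u} := by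
  -- Replaces `D` by the opposite of a category with objects and morphisms in universe `u`, so that
  -- the functors become presheaves on a category of the right size.
  let e : D ≌ (ULiftHom.{u} (ULift.{u} Dᵒᵖ))ᵒᵖ :=
    (opOpEquivalence D).symm.trans (ULiftHomULiftCategory.equiv.{u, u} Dᵒᵖ).op
  exact Equivalence.isCardinalLocallyPresentable (e.congrLeft (E := Type u)).symm _

/-! ### Finite limits of finitely corepresentable functors -/

section

variable {C : Type u₁} [Category.{u} C]

/-- The product of a family of functors to types. -/
@[simps]
def familyProductFunctor {ι : Type} (Φ : ι → C ⥤ Type u) : C ⥤ Type u where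
  obj X := ∀ i, (Φ i).obj X
  map f := ↾fun v i => (Φ i).map f (v i)

/-- The product of two functors to types. -/
@[simps]
def binaryProductFunctor (Φ Ψ : C ⥤ Type u) : C ⥤ Type u where
  obj X := Φ.obj X × Ψ.obj X
  map f := ↾fun v => (Φ.map f v.1, Ψ.map f v.2)

/-- The joint equalizer of a family of pairs of natural transformations between functors to
types. -/
@[simps]
def jointEqualizerFunctor {κ : Type} {Φ : C ⥤ Type u} {Ψ : κ → C ⥤ Type u} (α β : ∀ k, Φ ⟶ Ψ k) :
    C ⥤ Type u where
  obj X := {a : Φ.obj X // ∀ k, (α k).app X a = (β k).app X a}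
  map f := ↾fun a => ⟨Φ.map f a.1, fun k => by
    rw [NatTrans.naturality_apply, a.2, NatTrans.naturality_apply]⟩

namespace IsFinitelyCorepresentable

theorem isFinitelyPresentable_of_isColimit {K : Type} [SmallCategory K] [FinCategory K]
    {Y : K ⥤ C} {c : Cocone Y} (hc : IsColimit c) (h : ∀ k, IsFinitelyPresentable.{u} (Y.obj k)) :
    IsFinitelyPresentable.{u} c.pt :=
  isCardinalPresentable_of_isColimit' c hc _ (hasCardinalLT_of_finite _ _ le_rfl)

variable [HasFiniteColimits C]

/-- The coproduct of the corepresenting objects corepresents the product; it is a finite colimit of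
finitely presentable objects. -/
theorem familyProductFunctor {ι : Type} [Finite ι] {Φ : ι → C ⥤ Type u}
    (h : ∀ i, IsFinitelyCorepresentable (Φ i)) :
    IsFinitelyCorepresentable (familyProductFunctor Φ) := by
  choose A hA eA using h
  replace eA := fun i => (eA i).some
  have := Fintype.ofFinite ι
  classical
  refine ⟨∐ A, isFinitelyPresentable_of_isColimit (colimit.isColimit (Discrete.functor A))
    fun k => hA k.as, ⟨?_⟩⟩
  exact
    { homEquiv := fun {Y} =>
        { toFun := fun f i => (eA i).homEquiv (Sigma.ι A i ≫ f)
          invFun := fun v => Limits.Sigma.desc fun i => (eA i).homEquiv.symm (v i)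
          left_inv := fun f => by
            apply Sigma.hom_ext
            intro i
            simp
          right_inv := fun v => by
            funext i
            simp }
      homEquiv_comp := fun g f => by
        funext i
        change (eA i).homEquiv (Sigma.ι A i ≫ f ≫ g) = (Φ i).map g ((eA i).homEquiv _)
        rw [← (eA i).homEquiv_comp, Category.assoc] }

theorem binaryProductFunctor {Φ Ψ : C ⥤ Type u} (hΦ : IsFinitelyCorepresentable Φ)
    (hΨ : IsFinitelyCorepresentable Ψ) : IsFinitelyCorepresentable (binaryProductFunctor Φ Ψ) := by
  obtain ⟨A, hA, ⟨eA⟩⟩ := hΦ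
  obtain ⟨B, hB, ⟨eB⟩⟩ := hΨ
  refine ⟨A ⨿ B, isFinitelyPresentable_of_isColimit (colimit.isColimit (pair A B))
    (by rintro (_ | _) <;> assumption), ⟨?_⟩⟩
  exact
    { homEquiv := fun {Y} =>
        { toFun := fun f => (eA.homEquiv (coprod.inl ≫ f), eB.homEquiv (coprod.inr ≫ f))
          invFun := fun v => coprod.desc (eA.homEquiv.symm v.1) (eB.homEquiv.symm v.2)
          left_inv := fun f => by
            simp only [Equiv.symm_apply_apply]
            exact coprod.hom_ext (coprod.inl_desc _ _) (coprod.inr_desc _ _)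
          right_inv := fun v => by
            beta_reduce
            erw [coprod.inl_desc, coprod.inr_desc, Equiv.apply_symm_apply, Equiv.apply_symm_apply]
            rfl }
      homEquiv_comp := fun g f => by
        change _ = (Φ.map g (eA.homEquiv _), Ψ.map g (eB.homEquiv _))
        rw [← eA.homEquiv_comp, ← eB.homEquiv_comp, Category.assoc, Category.assoc]
        rfl }

/-- Yoneda turns the two families into parallel morphisms from the coproduct of the `B k` to `A`;
their coequalizer corepresents the joint equalizer. -/
theorem jointEqualizerFunctor {κ : Type} [Finite κ] {Φ : C ⥤ Type u} {Ψ : κ → C ⥤ Type u}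
    (α β : ∀ k, Φ ⟶ Ψ k) (hΦ : IsFinitelyCorepresentable Φ)
    (hΨ : ∀ k, IsFinitelyCorepresentable (Ψ k)) :
    IsFinitelyCorepresentable (jointEqualizerFunctor α β) := by
  obtain ⟨A, hA, ⟨eA⟩⟩ := hΦ
  choose B hB eB using hΨ
  replace eB := fun i => (eB i).some
  have := Fintype.ofFinite κ
  classical
  let a : ∐ B ⟶ A := Limits.Sigma.desc fun k => (eB k).homEquiv.symm ((α k).app A (eA.homEquiv (𝟙 A)))
  let b : ∐ B ⟶ A := Limits.Sigma.desc fun k => (eB k).homEquiv.symm ((β k).app A (eA.homEquiv (𝟙 A)))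
  have hB' : IsFinitelyPresentable.{u} (∐ B) :=
    isFinitelyPresentable_of_isColimit (colimit.isColimit (Discrete.functor B)) fun k => hB k.as
  -- A morphism out of `A` coequalizes `a` and `b` exactly if the element it names satisfies all the
  -- equations.
  have key : ∀ {Y : C} (f : A ⟶ Y), a ≫ f = b ≫ f ↔
      ∀ k, (α k).app Y (eA.homEquiv f) = (β k).app Y (eA.homEquiv f) := fun {Y} f => by
    rw [eA.homEquiv_eq f]
    constructor
    · intro h k
      have := congrArg (fun g => (eB k).homEquiv (Sigma.ι B k ≫ g)) h
      simpa [a, b, (eB k).homEquiv_comp, NatTrans.naturality_apply] using this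
    · intro h
      apply Sigma.hom_ext
      intro k
      apply (eB k).homEquiv.injective
      simpa [a, b, (eB k).homEquiv_comp, NatTrans.naturality_apply] using h k
  refine ⟨coequalizer a b, isFinitelyPresentable_of_isColimit
    (colimit.isColimit (parallelPair a b))
    (by rintro (_ | _) <;> assumption), ⟨?_⟩⟩
  exact
    { homEquiv := fun {Y} =>
        { toFun := fun f => ⟨eA.homEquiv (coequalizer.π a b ≫ f), (key _).1 (by
            rw [coequalizer.condition_assoc])⟩
          invFun := fun v => coequalizer.desc (eA.homEquiv.symm v.1) ((key _).2 (by
            simpa using v.2))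
          left_inv := fun f => by
            apply coequalizer.hom_ext
            simp
          right_inv := fun v => by
            apply Subtype.ext
            simp }
      homEquiv_comp := fun g f => by
        apply Subtype.ext
        change eA.homEquiv (coequalizer.π a b ≫ f ≫ g) = Φ.map g (eA.homEquiv _)
        rw [← eA.homEquiv_comp, Category.assoc] }

end IsFinitelyCorepresentable

end

/-! ### Sequents with unique existence -/

section

variable {D : Type} [SmallCategory D]

theorem isFinitelyCorepresentable_evaluation (d : D) :
    IsFinitelyCorepresentable ((evaluation D (Type u)).obj d) :=
  have : ((evaluation D (Type u)).obj d).IsRightAdjoint :=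
    (evaluationAdjunctionRight (Type u) d).isRightAdjoint
  .of_isRightAdjoint _

/-- An equation between values of two of the variables in a context `d`. -/
structure Equation {k : ℕ} (d : Fin k → D) where
  i : Fin k
  j : Fin k
  {e : D}
  f : d i ⟶ e
  g : d j ⟶ e

/-- The validity of an equation at an assignment. -/
def Equation.Holds {k : ℕ} {d : Fin k → D} (q : Equation d) {P : D ⥤ Type u}
    (v : ∀ i, P.obj (d i)) : Prop :=
  P.map q.f (v q.i) = P.map q.g (v q.j)

/-- A sequent: for all values of the variables in a context that satisfy the hypotheses, there
is a unique element that has prescribed images. -/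
structure Sequent (D : Type) [SmallCategory D] where
  {k : ℕ}
  (d : Fin k → D)
  {m : ℕ}
  (hyp : Fin m → Equation d)
  (r : D)
  {l : ℕ}
  (i : Fin l → Fin k)
  {e : Fin l → D}
  (f : ∀ c, r ⟶ e c)
  (g : ∀ c, d (i c) ⟶ e c)

namespace Sequent

variable (S : Sequent D)

/-- The validity of a sequent in a functor to types. -/
def Holds (P : D ⥤ Type u) : Prop :=
  ∀ v : ∀ i, P.obj (S.d i), (∀ c, (S.hyp c).Holds v) →
    ∃! x : P.obj S.r, ∀ c, P.map (S.f c) x = P.map (S.g c) (v (S.i c))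

/-- The functor of assignments for the variables of a sequent. -/
abbrev assignments : (D ⥤ Type u) ⥤ Type u :=
  familyProductFunctor fun i => (evaluation D (Type u)).obj (S.d i)

/-- The functor of assignments satisfying the hypotheses. -/
abbrev models : (D ⥤ Type u) ⥤ Type u :=
  jointEqualizerFunctor (Φ := S.assignments)
    (Ψ := fun c => (evaluation D (Type u)).obj (S.hyp c).e)
    (fun c => { app := fun P => ↾fun v => P.map (S.hyp c).f (v (S.hyp c).i) })
    (fun c => { app := fun P => ↾fun v => P.map (S.hyp c).g (v (S.hyp c).j) })

/-- The functor of pairs of an assignment satisfying the hypotheses and a witness for the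
conclusion. -/
abbrev witnesses : (D ⥤ Type u) ⥤ Type u :=
  jointEqualizerFunctor
    (Φ := binaryProductFunctor S.models ((evaluation D (Type u)).obj S.r))
    (Ψ := fun c => (evaluation D (Type u)).obj (S.e c))
    (fun c => { app := fun P => ↾fun v => P.map (S.f c) v.2 })
    (fun c => { app := fun P => ↾fun v => P.map (S.g c) (v.1.1 (S.i c)) })

/-- The projection that forgets the witness. -/
abbrev proj : S.witnesses.{u} ⟶ S.models where
  app P := ↾fun v => v.1.1

theorem isFinitelyCorepresentable_models : IsFinitelyCorepresentable S.models.{u} :=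
  .jointEqualizerFunctor _ _ (.familyProductFunctor fun _ => isFinitelyCorepresentable_evaluation _)
    fun _ => isFinitelyCorepresentable_evaluation _

theorem isFinitelyCorepresentable_witnesses : IsFinitelyCorepresentable S.witnesses.{u} :=
  .jointEqualizerFunctor _ _
    (.binaryProductFunctor S.isFinitelyCorepresentable_models (isFinitelyCorepresentable_evaluation _))
    fun _ => isFinitelyCorepresentable_evaluation _

/-- The fibre of `proj` over an assignment is the set of its witnesses. This is why conclusions are
unique existence: existence alone would give only surjectivity, which is not an orthogonality
condition. -/
theorem holds_iff (P : D ⥤ Type u) : S.Holds P ↔ Function.Bijective (S.proj.app P) := by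
  rw [Function.bijective_iff_existsUnique]
  constructor
  · intro h v
    obtain ⟨x, hx, hu⟩ := h v.1 v.2
    refine ⟨⟨(v, x), hx⟩, rfl, ?_⟩
    rintro ⟨⟨_, y⟩, hy⟩ rfl
    obtain rfl : y = x := hu _ hy
    rfl
  · intro h v hv
    obtain ⟨⟨⟨_, x⟩, hx⟩, rfl, hu⟩ := h ⟨v, hv⟩
    refine ⟨x, hx, fun y hy => ?_⟩
    exact congrArg (fun z : S.witnesses.obj P => z.1.2) (hu ⟨(⟨v, hv⟩, y), hy⟩ rfl)

end Sequent

/-- The models of a theory given by sequents. -/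
def theoryModels (T : Set (Sequent D)) : ObjectProperty (D ⥤ Type u) :=
  fun P => ∀ S ∈ T, S.Holds P

variable (T : Set (Sequent D))

/-- The sequents over a category in the lowest universe form a small type, so `T` may be any set of
them, however many it contains. -/
theorem theoryModels_eq : theoryModels.{u} T =
    bijectiveObjects (fun S : T => S.1.proj.{u}) := by
  ext P
  simp [theoryModels, bijectiveObjects, Sequent.holds_iff]

theorem isCardinalLocallyPresentable_theoryModels :
    IsCardinalLocallyPresentable (theoryModels.{u} T).FullSubcategory Cardinal.aleph0.{u} := by
  rw [theoryModels_eq]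
  exact isCardinalLocallyPresentable_bijectiveObjects _
    (fun S => S.1.isFinitelyCorepresentable_witnesses)
    (fun S => S.1.isFinitelyCorepresentable_models)

theorem isRightAdjoint_theoryModels_ι : (theoryModels.{u} T).ι.IsRightAdjoint := by
  rw [theoryModels_eq]
  exact isRightAdjoint_bijectiveObjects_ι _
    (fun S => S.1.isFinitelyCorepresentable_witnesses)
    (fun S => S.1.isFinitelyCorepresentable_models)

theorem isCardinalAccessible_theoryModels_ι :
    (theoryModels.{u} T).ι.IsCardinalAccessible Cardinal.aleph0.{u} := by
  rw [theoryModels_eq]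
  exact isCardinalAccessible_bijectiveObjects_ι _
    (fun S => S.1.isFinitelyCorepresentable_witnesses)
    (fun S => S.1.isFinitelyCorepresentable_models)

end

end CategoryTheory

/-! ### The category of shapes and the nerve of a stretching -/

namespace InftyN

open InfGraph

/-- The operations of an (∞,n)-categorical stretching; the Boolean distinguishes the (∞,n)-magma
`M` (`false`) from the strict (∞,n)-category `C` (`true`). -/
inductive Oper (n : ℕ) : Type
  | one (b : Bool) {p m : ℕ} (h : p < m)
  | comp (b : Bool) {p m : ℕ} (h : p < m)
  | rev (b : Bool) {p m : ℕ} (hn : n ≤ p) (h : p < m)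
  | proj (m : ℕ)
  | bracket (m : ℕ)

/-- The arguments and the value of an operation. -/
inductive Pt {n : ℕ} : Oper n → Type
  | oneArg (b : Bool) {p m : ℕ} (h : p < m) : Pt (.one b h)
  | oneVal (b : Bool) {p m : ℕ} (h : p < m) : Pt (.one b h)
  | compLeft (b : Bool) {p m : ℕ} (h : p < m) : Pt (.comp b h)
  | compRight (b : Bool) {p m : ℕ} (h : p < m) : Pt (.comp b h)
  | compVal (b : Bool) {p m : ℕ} (h : p < m) : Pt (.comp b h)
  | revArg (b : Bool) {p m : ℕ} (hn : n ≤ p) (h : p < m) : Pt (.rev b hn h)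
  | revVal (b : Bool) {p m : ℕ} (hn : n ≤ p) (h : p < m) : Pt (.rev b hn h)
  | projArg (m : ℕ) : Pt (.proj m)
  | projVal (m : ℕ) : Pt (.proj m)
  | bracketTgt (m : ℕ) : Pt (.bracket m)
  | bracketSrc (m : ℕ) : Pt (.bracket m)
  | bracketVal (m : ℕ) : Pt (.bracket m)

namespace Pt

variable {n : ℕ}

/-- The side on which an argument or a value lies. -/
@[reducible]
def side : {r : Oper n} → Pt r → Bool
  | _, oneArg b _ => b
  | _, oneVal b _ => b
  | _, compLeft b _ => b
  | _, compRight b _ => b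
  | _, compVal b _ => b
  | _, revArg b _ _ => b
  | _, revVal b _ _ => b
  | _, projArg _ => false
  | _, projVal _ => true
  | _, bracketTgt _ => false
  | _, bracketSrc _ => false
  | _, bracketVal _ => false

/-- The dimension of an argument or a value. -/
@[reducible]
def dim : {r : Oper n} → Pt r → ℕ
  | _, oneArg (p := p) _ _ => p
  | _, oneVal (m := m) _ _ => m
  | _, compLeft (m := m) _ _ => m
  | _, compRight (m := m) _ _ => m
  | _, compVal (m := m) _ _ => m
  | _, revArg (m := m) _ _ _ => m
  | _, revVal (m := m) _ _ _ => m
  | _, projArg m => m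
  | _, projVal m => m
  | _, bracketTgt m => m
  | _, bracketSrc m => m
  | _, bracketVal m => m + 1

end Pt

/-- Objects of the category of shapes: the cells on the two sides and the operations. -/
inductive Shape (n : ℕ) : Type
  | cell (b : Bool) (e : Globeᵒᵖ)
  | oper (r : Oper n)

namespace Shape

variable {n : ℕ}

/-- Morphisms of shapes: the globular operators, and the passages from an operation to its
arguments and its value. -/
inductive Hom : Shape n → Shape n → Type
  | cell (b : Bool) {e e' : Globeᵒᵖ} (θ : e ⟶ e') : Hom (.cell b e) (.cell b e')
  | id (r : Oper n) : Hom (.oper r) (.oper r)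
  | pt {r : Oper n} (i : Pt r) {e : Globeᵒᵖ} (θ : op ⟨i.dim⟩ ⟶ e) :
      Hom (.oper r) (.cell i.side e)

/-- Composition of morphisms of shapes. -/
def Hom.comp : {X Y Z : Shape n} → Hom X Y → Hom Y Z → Hom X Z
  | _, _, _, .cell b θ, .cell _ φ => .cell b (θ ≫ φ)
  | _, _, _, .id _, g => g
  | _, _, _, .pt i θ, .cell _ φ => .pt i (θ ≫ φ)

instance : SmallCategory (Shape n) where
  Hom := Hom
  id
    | .cell b e => .cell b (𝟙 e)
    | .oper r => .id r
  comp := Hom.comp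
  id_comp f := by
    cases f <;> simp [Hom.comp]
  comp_id f := by
    cases f <;> simp [Hom.comp]
  assoc f g h := by
    cases f <;> cases g <;> cases h <;> simp [Hom.comp]

/-- A globular operator. -/
def mapCell (b : Bool) {e e' : Globeᵒᵖ} (θ : e ⟶ e') : cell (n := n) b e ⟶ cell b e' :=
  Hom.cell b θ

/-- The passage from an operation to an argument or its value. -/
def pt {r : Oper n} (i : Pt r) : oper r ⟶ cell i.side (op ⟨i.dim⟩) :=
  Hom.pt i (𝟙 _)

/-- The inclusion of the cells of one side. -/
def incl (b : Bool) : Globeᵒᵖ ⥤ Shape n where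
  obj e := cell b e
  map θ := mapCell b θ
  map_id _ := rfl
  map_comp _ _ := rfl

end Shape

/-- The action of a morphism of globes on the cells of an ∞-graph, by cases. -/
def InfGraph.act (X : InfGraph.{u}) : {p m : ℕ} → GlobeHom p m → X.Cell m → X.Cell p
  | _, _, .id _ => fun x => x
  | _, _, .s h => fun x => src h x
  | _, _, .t h => fun x => tgt h x

/-- With `act` defined by cases, the identity acts as the identity by definition, so in the nerve of
a stretching `Shape.pt i` reduces to `point i`. This lemma returns to the functorial action where
naturality is needed. -/
theorem InfGraph.act_eq (X : InfGraph.{u}) {e e' : Globeᵒᵖ} (θ : e ⟶ e') (x : X.obj e) :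
    X.act θ.unop x = X.map θ x := by
  obtain ⟨⟨p⟩⟩ := e
  obtain ⟨⟨m⟩⟩ := e'
  obtain ⟨θ⟩ := θ
  change GlobeHom m p at θ
  cases θ
  · exact congr($(X.map_id _) x).symm
  · rfl
  · rfl

namespace Stretching

variable {n : ℕ} (E : Stretching.{u} n)

/-- The two (∞,n)-magmas of a stretching. -/
@[reducible]
noncomputable def side : Bool → NMagma.{u} n
  | false => E.M
  | true => E.C.toNMagma

/-- The domain of definition of an operation. -/
noncomputable def Dom : Oper n → Type u
  | .one (p := p) b _ => (E.side b).graph.Cell p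
  | .comp (m := m) b h =>
    {c : (E.side b).graph.Cell m × (E.side b).graph.Cell m // src h c.1 = tgt h c.2}
  | .rev (m := m) b _ _ => (E.side b).graph.Cell m
  | .proj m => E.M.graph.Cell m
  | .bracket m => {c : E.M.graph.Cell m × E.M.graph.Cell m //
      Parallel c.1 c.2 ∧ InfGraph.mapCell E.π.graphHom c.1 = InfGraph.mapCell E.π.graphHom c.2}

/-- The arguments and the value of an operation. -/
noncomputable def point : {r : Oper n} → (i : Pt r) → E.Dom r → (E.side i.side).graph.Cell i.dim
  | _, .oneArg _ _, x => x
  | _, .oneVal b h, x => (E.side b).one h x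
  | _, .compLeft _ _, c => c.1.1
  | _, .compRight _ _, c => c.1.2
  | _, .compVal b h, c => (E.side b).comp h c.1.1 c.1.2 c.2
  | _, .revArg _ _ _, x => x
  | _, .revVal b hn h, x => (E.side b).rev hn h x
  | _, .projArg _, x => x
  | _, .projVal _, x => InfGraph.mapCell E.π.graphHom x
  | _, .bracketTgt _, c => c.1.1
  | _, .bracketSrc _, c => c.1.2
  | _, .bracketVal _, c => E.bracket c.1.1 c.1.2 c.2.1 c.2.2

/-- The values of the nerve of a stretching. -/
noncomputable def NerveObj : Shape n → Type u
  | .cell b e => (E.side b).graph.obj e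
  | .oper r => E.Dom r

/-- The action of the morphisms of shapes on the nerve of a stretching. -/
noncomputable def nerveMap : {X Y : Shape n} → Shape.Hom X Y → E.NerveObj X → E.NerveObj Y
  | _, _, .cell b θ => fun x => (E.side b).graph.map θ x
  | _, _, .id _ => fun x => x
  | _, _, .pt i θ => fun x => (E.side i.side).graph.act θ.unop (E.point i x)

/-- The nerve of a stretching. -/
noncomputable def nerve : Shape n ⥤ Type u where
  obj := E.NerveObj
  map f := ↾(E.nerveMap f)
  map_id X := by
    cases X
    · ext x
      exact congr($((E.side _).graph.map_id _) x)
    · rfl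
  map_comp f g := by
    ext x
    change Shape.Hom _ _ at f g
    cases f <;> cases g
    · exact Functor.map_comp_apply _ _ _ _
    · rfl
    · rfl
    · rename_i r i e θ e' φ
      change (E.side i.side).graph.act (θ ≫ φ).unop (E.point i x) =
        (E.side i.side).graph.map φ ((E.side i.side).graph.act θ.unop (E.point i x))
      rw [act_eq, act_eq, Functor.map_comp_apply]

variable {E} {F : Stretching.{u} n} (f : E ⟶ F)

/-- The two morphisms of (∞,n)-magmas of a morphism of stretchings. -/
@[reducible]
noncomputable def Hom.side (f : E ⟶ F) : (b : Bool) → (E.side b ⟶ F.side b)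
  | false => Hom.magmaHom f
  | true => Hom.catHom f

theorem Hom.π_apply {m : ℕ} (x : E.M.graph.Cell m) :
    InfGraph.mapCell F.π.graphHom (InfGraph.mapCell (Hom.magmaHom f).graphHom x) =
      InfGraph.mapCell (Hom.catHom f).graphHom (InfGraph.mapCell E.π.graphHom x) :=
  congrArg (fun k : E.M ⟶ F.C.toNMagma => InfGraph.mapCell k.graphHom x) (Hom.w f)

/-- The action of a morphism of stretchings on the domains of the operations. -/
noncomputable def Hom.domMap : (r : Oper n) → E.Dom r → F.Dom r
  | .one b _, x => InfGraph.mapCell (Hom.side f b).graphHom x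
  | .comp b h, c => ⟨(InfGraph.mapCell (Hom.side f b).graphHom c.1.1,
      InfGraph.mapCell (Hom.side f b).graphHom c.1.2), by
        rw [← mapCell_src, c.2, mapCell_tgt]⟩
  | .rev b _ _, x => InfGraph.mapCell (Hom.side f b).graphHom x
  | .proj _, x => InfGraph.mapCell (Hom.magmaHom f).graphHom x
  | .bracket _, c => ⟨(InfGraph.mapCell (Hom.magmaHom f).graphHom c.1.1,
      InfGraph.mapCell (Hom.magmaHom f).graphHom c.1.2), c.2.1.map _, π_map_eq (Hom.w f) c.2.2⟩

/-- For arguments this holds by definition; for values it is precisely the preservation of the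
corresponding operation. -/
theorem Hom.point_domMap {r : Oper n} (i : Pt r) (x : E.Dom r) :
    F.point i (Hom.domMap f r x) =
      InfGraph.mapCell (Hom.side f i.side).graphHom (E.point i x) := by
  cases i
  · rfl
  · exact ((Hom.side f _).isInfMagmaHom.map_one _ _).symm
  · rfl
  · rfl
  · exact ((Hom.side f _).isInfMagmaHom.map_comp _ _ _ _).symm
  · rfl
  · exact ((Hom.side f _).map_rev _ _ _).symm
  · rfl
  · exact Hom.π_apply f _
  · rfl
  · rfl
  · exact (Hom.map_bracket f _ _ _ _).symm

/-- The components of the action of a morphism of stretchings on nerves. -/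
noncomputable def Hom.nerveApp (f : E ⟶ F) : (X : Shape n) → E.NerveObj X → F.NerveObj X
  | .cell b e => (Hom.side f b).graphHom.app e
  | .oper r => Hom.domMap f r

end Stretching

/-- The nerve functor of stretchings. -/
noncomputable def stretchingNerve (n : ℕ) : Stretching.{u} n ⥤ Shape n ⥤ Type u where
  obj E := E.nerve
  map {E F} f :=
    { app := fun X => ↾(Stretching.Hom.nerveApp f X)
      naturality := fun X Y g => by
        ext x
        change Shape.Hom _ _ at g
        cases g with
        | cell b θ => exact NatTrans.naturality_apply (Stretching.Hom.side f b).graphHom θ x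
        | id r => rfl
        | pt i θ =>
          change InfGraph.mapCell (Stretching.Hom.side f i.side).graphHom
              ((E.side i.side).graph.act θ.unop (E.point i x)) =
            (F.side i.side).graph.act θ.unop (F.point i (Stretching.Hom.domMap f _ x))
          rw [act_eq, act_eq]
          exact (NatTrans.naturality_apply (Stretching.Hom.side f i.side).graphHom θ _).trans
            (congrArg _ (Stretching.Hom.point_domMap f i x).symm) }
  map_id E := by
    ext X x
    rcases X with ⟨b, e⟩ | ⟨b, h⟩ | ⟨b, h⟩ | ⟨b, hn, h⟩ | _ | _
    iterate 4 cases b <;> rfl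
    · rfl
    · rfl
  map_comp f g := by
    ext X x
    rcases X with ⟨b, e⟩ | ⟨b, h⟩ | ⟨b, h⟩ | ⟨b, hn, h⟩ | _ | _
    iterate 4 cases b <;> rfl
    · rfl
    · rfl

/-! ### Full faithfulness of the nerve -/

namespace Stretching

variable {n : ℕ} {E F : Stretching.{u} n}

/-- Each domain is carved out of a product of sets of cells, so arguments alone determine an
element. Hence a morphism of nerves is determined by its components on cells. -/
theorem dom_ext {r : Oper n} {x y : E.Dom r} (h : ∀ i : Pt r, E.point i x = E.point i y) :
    x = y := by
  cases r
  · exact h (.oneArg _ _)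
  · exact Subtype.ext (Prod.ext (h (.compLeft _ _)) (h (.compRight _ _)))
  · exact h (.revArg _ _ _)
  · exact h (.projArg _)
  · exact Subtype.ext (Prod.ext (h (.bracketTgt _)) (h (.bracketSrc _)))

variable (τ : E.nerve ⟶ F.nerve)

/-- At the arguments this identifies the image of an element of `E.Dom r`; at the value it then says
that the operation is preserved. -/
theorem point_nerveHom {r : Oper n} (i : Pt r) (x : E.Dom r) :
    F.point i (τ.app (.oper r) x) = τ.app (.cell i.side (op ⟨i.dim⟩)) (E.point i x) :=
  (NatTrans.naturality_apply τ (Shape.pt i) x).symm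

/-- The morphism of ∞-graphs on one side underlying a morphism of nerves. -/
noncomputable def graphHomOfNerveHom (b : Bool) : (E.side b).graph ⟶ (F.side b).graph where
  app e := τ.app (.cell b e)
  naturality _ _ θ := τ.naturality (Shape.mapCell b θ)

/-- The morphism of (∞,n)-magmas on one side underlying a morphism of nerves. -/
noncomputable def sideOfNerveHom (b : Bool) : NMagma.Hom (E.side b) (F.side b) where
  graphHom := graphHomOfNerveHom τ b
  isInfMagmaHom :=
    { map_one := fun h x =>
        (point_nerveHom τ (.oneVal b h) x).symm.trans
          (congrArg ((F.side b).one h) (point_nerveHom τ (.oneArg b h) x))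
      map_comp := fun h y x hyx =>
        (point_nerveHom τ (.compVal b h) ⟨(y, x), hyx⟩).symm.trans
          ((F.side b).comp_congr h (point_nerveHom τ (.compLeft b h) ⟨(y, x), hyx⟩)
            (point_nerveHom τ (.compRight b h) ⟨(y, x), hyx⟩) _) }
  map_rev hn h x :=
    (point_nerveHom τ (.revVal b hn h) x).symm.trans
      (congrArg ((F.side b).rev hn h) (point_nerveHom τ (.revArg b hn h) x))

theorem bracket_congr {m : ℕ} {c₁ c₁' c₀ c₀' : E.M.graph.Cell m} (h₁ : c₁ = c₁') (h₀ : c₀ = c₀')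
    (hpar : Parallel c₁ c₀) (hπ : mapCell E.π.graphHom c₁ = mapCell E.π.graphHom c₀) :
    E.bracket c₁ c₀ hpar hπ = E.bracket c₁' c₀' (h₁ ▸ h₀ ▸ hpar) (h₁ ▸ h₀ ▸ hπ) := by
  subst h₁ h₀
  rfl

/-- The morphism of stretchings underlying a morphism of nerves. -/
noncomputable def ofNerveHom : Hom E F where
  magmaHom := sideOfNerveHom τ false
  catHom := sideOfNerveHom τ true
  w := by
    apply NMagma.Hom.ext
    apply NatTrans.ext
    funext e
    ext x
    exact (congrArg (mapCell F.π.graphHom) (point_nerveHom τ (.projArg e.unop.dim) x)).symm.trans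
      (point_nerveHom τ (.projVal e.unop.dim) x)
  map_bracket {m} c₁ c₀ hpar hπ :=
    (point_nerveHom τ (.bracketVal m) ⟨(c₁, c₀), hpar, hπ⟩).symm.trans
      (bracket_congr (point_nerveHom τ (.bracketTgt m) ⟨(c₁, c₀), hpar, hπ⟩)
        (point_nerveHom τ (.bracketSrc m) ⟨(c₁, c₀), hpar, hπ⟩) _ _)

end Stretching

theorem stretchingNerve_map_ofNerveHom {n : ℕ} {E F : Stretching.{u} n} (τ : E.nerve ⟶ F.nerve) :
    (stretchingNerve n).map (Stretching.ofNerveHom τ : E ⟶ F) = τ := by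
  -- `Hom.side` is defined by cases on the Boolean, so the equality becomes definitional only after
  -- splitting.
  have hcell : ∀ b e (x : (E.side b).graph.obj e),
      (Stretching.Hom.side (Stretching.ofNerveHom τ : E ⟶ F) b).graphHom.app e x =
        τ.app (.cell b e) x := by
    rintro (_ | _) e x <;> rfl
  ext X x
  cases X with
  | cell b e => exact hcell b e x
  | oper r =>
    apply Stretching.dom_ext
    intro i
    exact ((Stretching.Hom.point_domMap _ i x).trans (hcell _ _ _)).trans
      (Stretching.point_nerveHom τ i x).symm

instance (n : ℕ) : (stretchingNerve.{u} n).Full where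
  map_surjective τ := ⟨_, stretchingNerve_map_ofNerveHom τ⟩

instance (n : ℕ) : (stretchingNerve.{u} n).Faithful where
  map_injective {E F} f g h := by
    have key : ∀ b, Stretching.Hom.side f b = Stretching.Hom.side g b := fun b => by
      apply NMagma.Hom.ext
      apply NatTrans.ext
      funext e
      exact congrArg (fun τ : E.nerve ⟶ F.nerve => τ.app (.cell b e)) h
    exact Stretching.Hom.ext (key false) (key true)

/-! ### The theory of stretchings -/

/-- The sequents that are valid in the nerves of all stretchings. -/
def stretchingTheory (n : ℕ) : Set (Sequent (Shape n)) :=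
  {S | ∀ E : Stretching.{u} n, S.Holds E.nerve}

namespace Shape

variable {n : ℕ}

/-- The passage from an operation to the source of an argument or its value. -/
def ptSrc {r : Oper n} (i : Pt r) {p : ℕ} (h : p < i.dim) : oper r ⟶ cell i.side (op ⟨p⟩) :=
  Hom.pt i (Globe.s h).op

/-- The passage from an operation to the target of an argument or its value. -/
def ptTgt {r : Oper n} (i : Pt r) {p : ℕ} (h : p < i.dim) : oper r ⟶ cell i.side (op ⟨p⟩) :=
  Hom.pt i (Globe.t h).op

end Shape

/-! ### Rebuilding a stretching from a model of the theory -/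

namespace Model

variable {n : ℕ} (P : Shape n ⥤ Type u)

/-- The ∞-graph of the cells on one side. -/
abbrev graph (b : Bool) : InfGraph.{u} := Shape.incl b ⋙ P

variable {P}

/-- An argument or the value of an element of an operation. -/
abbrev val {r : Oper n} (i : Pt r) (x : P.obj (.oper r)) : (graph P i.side).Cell i.dim :=
  P.map (Shape.pt i) x

theorem map_ptSrc {r : Oper n} (i : Pt r) {p : ℕ} (h : p < i.dim) (x : P.obj (.oper r)) :
    P.map (Shape.ptSrc i h) x = src h (val i x) :=
  Functor.map_comp_apply P (Shape.pt i) (Shape.mapCell i.side (Globe.s h).op) x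

theorem map_ptTgt {r : Oper n} (i : Pt r) {p : ℕ} (h : p < i.dim) (x : P.obj (.oper r)) :
    P.map (Shape.ptTgt i h) x = tgt h (val i x) :=
  Functor.map_comp_apply P (Shape.pt i) (Shape.mapCell i.side (Globe.t h).op) x

theorem map_hom_pt {r : Oper n} (i : Pt r) {e : Globeᵒᵖ} (θ : op ⟨i.dim⟩ ⟶ e)
    (x : P.obj (.oper r)) :
    P.map (Shape.Hom.pt i θ : Shape.oper r ⟶ .cell i.side e) x =
      (graph P i.side).map θ (val i x) := by
  have : (Shape.Hom.pt i θ : Shape.oper r ⟶ .cell i.side e) =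
      Shape.pt i ≫ Shape.mapCell i.side θ :=
    congrArg (Shape.Hom.pt i) (Category.id_comp θ).symm
  rw [this]
  exact Functor.map_comp_apply P (Shape.pt i) (Shape.mapCell i.side θ) x

variable (hP : theoryModels (stretchingTheory.{u} n) P)

include hP

/-- An equation is itself a unique existence statement: it holds exactly if some element, then
necessarily unique, equals both sides. So any implication between equations that is valid in all
stretchings belongs to the theory and passes to models. -/
theorem horn {k : ℕ} (d : Fin k → Shape n) {m : ℕ} (hyp : Fin m → Equation d) (q : Equation d)
    (H : ∀ (E : Stretching.{u} n) (v : ∀ i, E.nerve.obj (d i)),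
      (∀ c, (hyp c).Holds v) → q.Holds v)
    (v : ∀ i, P.obj (d i)) (hv : ∀ c, (hyp c).Holds v) : q.Holds v := by
  let S : Sequent (Shape n) :=
    { d := d
      hyp := hyp
      r := q.e
      l := 2
      i := ![q.i, q.j]
      e := fun _ => q.e
      f := fun _ => 𝟙 _
      g := fun | 0 => q.f | 1 => q.g }
  have hS : S ∈ stretchingTheory n := fun E w hw => by
    refine ⟨E.nerve.map q.f (w q.i), ?_, fun y hy => ?_⟩
    · rintro (_ : Fin 2)
      rename_i c
      fin_cases c
      · exact congr($(E.nerve.map_id _) _)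
      · exact congr($(E.nerve.map_id _) _).trans (H E w hw)
    · exact congr($(E.nerve.map_id _) _).symm.trans (hy 0)
  obtain ⟨x, hx, -⟩ := hP S hS v hv
  exact (hx 0).symm.trans (hx 1)

theorem existsUnique {k : ℕ} (d : Fin k → Shape n) {m : ℕ} (hyp : Fin m → Equation d)
    (r : Shape n) {e : Fin k → Shape n} (f : ∀ c, r ⟶ e c) (g : ∀ c, d c ⟶ e c)
    (H : ∀ (E : Stretching.{u} n) (v : ∀ i, E.nerve.obj (d i)), (∀ c, (hyp c).Holds v) →
      ∃! x : E.nerve.obj r, ∀ c, E.nerve.map (f c) x = E.nerve.map (g c) (v c))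
    (v : ∀ i, P.obj (d i)) (hv : ∀ c, (hyp c).Holds v) :
    ∃! x : P.obj r, ∀ c, P.map (f c) x = P.map (g c) (v c) :=
  hP { d := d, hyp := hyp, r := r, i := fun c => c, f := f, g := g } H v hv

/-! #### Equations -/

variable (b : Bool)

theorem src_oneVal {p m : ℕ} (h : p < m) (r : P.obj (.oper (.one b h))) :
    src h (val (.oneVal b h) r) = val (.oneArg b h) r :=
  (map_ptSrc (.oneVal b h) h r).symm.trans <|
    horn hP ![.oper (.one b h)] ![] ⟨0, 0, Shape.ptSrc (.oneVal b h) h, Shape.pt (.oneArg b h)⟩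
      (fun E v _ => (E.side b).src_one h (v 0)) (fun | 0 => r) (fun c => c.elim0)

theorem tgt_oneVal {p m : ℕ} (h : p < m) (r : P.obj (.oper (.one b h))) :
    tgt h (val (.oneVal b h) r) = val (.oneArg b h) r :=
  (map_ptTgt (.oneVal b h) h r).symm.trans <|
    horn hP ![.oper (.one b h)] ![] ⟨0, 0, Shape.ptTgt (.oneVal b h) h, Shape.pt (.oneArg b h)⟩
      (fun E v _ => (E.side b).tgt_one h (v 0)) (fun | 0 => r) (fun c => c.elim0)

/-- In a model an operation is a set of elements with arguments and a value, not yet a function.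
Each occurrence of an operation in an axiom therefore gets its own variable, and nesting becomes an
equation between an argument and a value. The later axioms follow the same pattern. -/
theorem oneVal_oneVal {p q m : ℕ} (h : p < q) (k : q < m) (r : P.obj (.oper (.one b h)))
    (r' : P.obj (.oper (.one b k))) (r'' : P.obj (.oper (.one b (h.trans k))))
    (h₁ : val (.oneArg b k) r' = val (.oneVal b h) r)
    (h₂ : val (.oneArg b (h.trans k)) r'' = val (.oneArg b h) r) :
    val (.oneVal b k) r' = val (.oneVal b (h.trans k)) r'' :=
  horn hP ![.oper (.one b h), .oper (.one b k), .oper (.one b (h.trans k))]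
    ![⟨1, 0, Shape.pt (.oneArg b k), Shape.pt (.oneVal b h)⟩,
      ⟨2, 0, Shape.pt (.oneArg b (h.trans k)), Shape.pt (.oneArg b h)⟩]
    ⟨1, 2, Shape.pt (.oneVal b k), Shape.pt (.oneVal b (h.trans k))⟩
    (fun E v hv => by
      have key : ∀ r₀ r₁ r₂ : (E.side b).graph.Cell _, r₁ = (E.side b).one h r₀ → r₂ = r₀ →
          (E.side b).one k r₁ = (E.side b).one (h.trans k) r₂ := by
        rintro r₀ r₁ r₂ rfl rfl
        exact (E.side b).one_one h k _
      exact key (v 0) (v 1) (v 2) (hv 0) (hv 1))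
    (fun | 0 => r | 1 => r' | 2 => r'') (fun | 0 => h₁ | 1 => h₂)

theorem src_compLeft {p m : ℕ} (h : p < m) (r : P.obj (.oper (.comp b h))) :
    src h (val (.compLeft b h) r) = tgt h (val (.compRight b h) r) :=
  (map_ptSrc (.compLeft b h) h r).symm.trans <| .trans
    (horn hP ![.oper (.comp b h)] ![]
      ⟨0, 0, Shape.ptSrc (.compLeft b h) h, Shape.ptTgt (.compRight b h) h⟩
      (fun E v _ => (show E.Dom (.comp b h) from v 0).2) (fun | 0 => r) (fun c => c.elim0))
    (map_ptTgt (.compRight b h) h r)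

theorem src_compVal {q p m : ℕ} (h : q ≤ p) (k : p < m) (r : P.obj (.oper (.comp b k))) :
    src (h.trans_lt k) (val (.compVal b k) r) = src (h.trans_lt k) (val (.compRight b k) r) :=
  (map_ptSrc (.compVal b k) (show q < m from h.trans_lt k) r).symm.trans <| .trans
    (horn hP ![.oper (.comp b k)] ![]
      ⟨0, 0, Shape.ptSrc (.compVal b k) (show q < m from h.trans_lt k),
         Shape.ptSrc (.compRight b k) (show q < m from h.trans_lt k)⟩
      (fun E v _ => (E.side b).src_comp_of_le h k _ _ (show E.Dom (.comp b k) from v 0).2)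
      (fun | 0 => r) (fun c => c.elim0))
    (map_ptSrc (.compRight b k) (show q < m from h.trans_lt k) r)

theorem tgt_compVal {q p m : ℕ} (h : q ≤ p) (k : p < m) (r : P.obj (.oper (.comp b k))) :
    tgt (h.trans_lt k) (val (.compVal b k) r) = tgt (h.trans_lt k) (val (.compLeft b k) r) :=
  (map_ptTgt (.compVal b k) (show q < m from h.trans_lt k) r).symm.trans <| .trans
    (horn hP ![.oper (.comp b k)] ![]
      ⟨0, 0, Shape.ptTgt (.compVal b k) (show q < m from h.trans_lt k),
         Shape.ptTgt (.compLeft b k) (show q < m from h.trans_lt k)⟩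
      (fun E v _ => (E.side b).tgt_comp_of_le h k _ _ (show E.Dom (.comp b k) from v 0).2)
      (fun | 0 => r) (fun c => c.elim0))
    (map_ptTgt (.compLeft b k) (show q < m from h.trans_lt k) r)

theorem src_compVal_of_lt {p q m : ℕ} (h : p < q) (k : q < m)
    (r : P.obj (.oper (.comp b (h.trans k)))) (r' : P.obj (.oper (.comp b h)))
    (h₁ : val (.compLeft b h) r' = src k (val (.compLeft b (h.trans k)) r))
    (h₂ : val (.compRight b h) r' = src k (val (.compRight b (h.trans k)) r)) :
    src k (val (.compVal b (h.trans k)) r) = val (.compVal b h) r' :=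
  (map_ptSrc (.compVal b (h.trans k)) k r).symm.trans <|
    horn hP ![.oper (.comp b (h.trans k)), .oper (.comp b h)]
      ![⟨1, 0, Shape.pt (.compLeft b h), Shape.ptSrc (.compLeft b (h.trans k)) k⟩,
        ⟨1, 0, Shape.pt (.compRight b h), Shape.ptSrc (.compRight b (h.trans k)) k⟩]
      ⟨0, 1, Shape.ptSrc (.compVal b (h.trans k)) k, Shape.pt (.compVal b h)⟩
      (fun E v hv =>
        ((E.side b).src_comp_of_lt h k _ _ (show E.Dom (.comp b (h.trans k)) from v 0).2).trans
          ((E.side b).comp_congr h (hv 0).symm (hv 1).symm _))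
      (fun | 0 => r | 1 => r')
      (fun
        | 0 => h₁.trans (map_ptSrc (.compLeft b (h.trans k)) k r).symm
        | 1 => h₂.trans (map_ptSrc (.compRight b (h.trans k)) k r).symm)

theorem tgt_compVal_of_lt {p q m : ℕ} (h : p < q) (k : q < m)
    (r : P.obj (.oper (.comp b (h.trans k)))) (r' : P.obj (.oper (.comp b h)))
    (h₁ : val (.compLeft b h) r' = tgt k (val (.compLeft b (h.trans k)) r))
    (h₂ : val (.compRight b h) r' = tgt k (val (.compRight b (h.trans k)) r)) :
    tgt k (val (.compVal b (h.trans k)) r) = val (.compVal b h) r' :=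
  (map_ptTgt (.compVal b (h.trans k)) k r).symm.trans <|
    horn hP ![.oper (.comp b (h.trans k)), .oper (.comp b h)]
      ![⟨1, 0, Shape.pt (.compLeft b h), Shape.ptTgt (.compLeft b (h.trans k)) k⟩,
        ⟨1, 0, Shape.pt (.compRight b h), Shape.ptTgt (.compRight b (h.trans k)) k⟩]
      ⟨0, 1, Shape.ptTgt (.compVal b (h.trans k)) k, Shape.pt (.compVal b h)⟩
      (fun E v hv =>
        ((E.side b).tgt_comp_of_lt h k _ _ (show E.Dom (.comp b (h.trans k)) from v 0).2).trans
          ((E.side b).comp_congr h (hv 0).symm (hv 1).symm _))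
      (fun | 0 => r | 1 => r')
      (fun
        | 0 => h₁.trans (map_ptTgt (.compLeft b (h.trans k)) k r).symm
        | 1 => h₂.trans (map_ptTgt (.compRight b (h.trans k)) k r).symm)

theorem src_revVal_succ {p : ℕ} (hn : n ≤ p) (r : P.obj (.oper (.rev b hn p.lt_succ_self))) :
    src p.lt_succ_self (val (.revVal b hn p.lt_succ_self) r) =
      tgt p.lt_succ_self (val (.revArg b hn p.lt_succ_self) r) :=
  (map_ptSrc (.revVal b hn p.lt_succ_self) p.lt_succ_self r).symm.trans <| .trans
    (horn hP ![.oper (.rev b hn p.lt_succ_self)] ![]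
      ⟨0, 0, Shape.ptSrc (.revVal b hn p.lt_succ_self) p.lt_succ_self,
        Shape.ptTgt (.revArg b hn p.lt_succ_self) p.lt_succ_self⟩
      (fun E v _ => (E.side b).src_rev_succ hn (v 0)) (fun | 0 => r) (fun c => c.elim0))
    (map_ptTgt (.revArg b hn p.lt_succ_self) p.lt_succ_self r)

theorem tgt_revVal_succ {p : ℕ} (hn : n ≤ p) (r : P.obj (.oper (.rev b hn p.lt_succ_self))) :
    tgt p.lt_succ_self (val (.revVal b hn p.lt_succ_self) r) =
      src p.lt_succ_self (val (.revArg b hn p.lt_succ_self) r) :=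
  (map_ptTgt (.revVal b hn p.lt_succ_self) p.lt_succ_self r).symm.trans <| .trans
    (horn hP ![.oper (.rev b hn p.lt_succ_self)] ![]
      ⟨0, 0, Shape.ptTgt (.revVal b hn p.lt_succ_self) p.lt_succ_self,
        Shape.ptSrc (.revArg b hn p.lt_succ_self) p.lt_succ_self⟩
      (fun E v _ => (E.side b).tgt_rev_succ hn (v 0)) (fun | 0 => r) (fun c => c.elim0))
    (map_ptSrc (.revArg b hn p.lt_succ_self) p.lt_succ_self r)

theorem src_revVal {p m : ℕ} (hn : n ≤ p) (h : p < m)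
    (r : P.obj (.oper (.rev b hn (h.trans m.lt_succ_self)))) (r' : P.obj (.oper (.rev b hn h)))
    (h₁ : val (.revArg b hn h) r' =
      src m.lt_succ_self (val (.revArg b hn (h.trans m.lt_succ_self)) r)) :
    src m.lt_succ_self (val (.revVal b hn (h.trans m.lt_succ_self)) r) = val (.revVal b hn h) r' :=
  (map_ptSrc (.revVal b hn (h.trans m.lt_succ_self)) m.lt_succ_self r).symm.trans <|
    horn hP ![.oper (.rev b hn (h.trans m.lt_succ_self)), .oper (.rev b hn h)]
      ![⟨1, 0, Shape.pt (.revArg b hn h),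
        Shape.ptSrc (.revArg b hn (h.trans m.lt_succ_self)) m.lt_succ_self⟩]
      ⟨0, 1, Shape.ptSrc (.revVal b hn (h.trans m.lt_succ_self)) m.lt_succ_self,
        Shape.pt (.revVal b hn h)⟩
      (fun E v hv => ((E.side b).src_rev hn h (v 0)).trans
        (congrArg ((E.side b).rev hn h) (hv 0).symm))
      (fun | 0 => r | 1 => r')
      (fun
        | 0 => h₁.trans (map_ptSrc (.revArg b hn (h.trans m.lt_succ_self)) m.lt_succ_self r).symm)

theorem tgt_revVal {p m : ℕ} (hn : n ≤ p) (h : p < m)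
    (r : P.obj (.oper (.rev b hn (h.trans m.lt_succ_self)))) (r' : P.obj (.oper (.rev b hn h)))
    (h₁ : val (.revArg b hn h) r' =
      tgt m.lt_succ_self (val (.revArg b hn (h.trans m.lt_succ_self)) r)) :
    tgt m.lt_succ_self (val (.revVal b hn (h.trans m.lt_succ_self)) r) = val (.revVal b hn h) r' :=
  (map_ptTgt (.revVal b hn (h.trans m.lt_succ_self)) m.lt_succ_self r).symm.trans <|
    horn hP ![.oper (.rev b hn (h.trans m.lt_succ_self)), .oper (.rev b hn h)]
      ![⟨1, 0, Shape.pt (.revArg b hn h),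
        Shape.ptTgt (.revArg b hn (h.trans m.lt_succ_self)) m.lt_succ_self⟩]
      ⟨0, 1, Shape.ptTgt (.revVal b hn (h.trans m.lt_succ_self)) m.lt_succ_self,
        Shape.pt (.revVal b hn h)⟩
      (fun E v hv => ((E.side b).tgt_rev hn h (v 0)).trans
        (congrArg ((E.side b).rev hn h) (hv 0).symm))
      (fun | 0 => r | 1 => r')
      (fun
        | 0 => h₁.trans (map_ptTgt (.revArg b hn (h.trans m.lt_succ_self)) m.lt_succ_self r).symm)

theorem assoc {p m : ℕ} (h : p < m) (zy yx l r : P.obj (.oper (.comp true h)))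
    (h₁ : val (.compLeft true h) yx = val (.compRight true h) zy)
    (h₂ : val (.compLeft true h) l = val (.compVal true h) zy)
    (h₃ : val (.compRight true h) l = val (.compRight true h) yx)
    (h₄ : val (.compLeft true h) r = val (.compLeft true h) zy)
    (h₅ : val (.compRight true h) r = val (.compVal true h) yx) :
    val (.compVal true h) l = val (.compVal true h) r :=
  horn hP (fun _ : Fin 4 => .oper (.comp true h))
    ![⟨1, 0, Shape.pt (.compLeft true h), Shape.pt (.compRight true h)⟩,
      ⟨2, 0, Shape.pt (.compLeft true h), Shape.pt (.compVal true h)⟩,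
      ⟨2, 1, Shape.pt (.compRight true h), Shape.pt (.compRight true h)⟩,
      ⟨3, 0, Shape.pt (.compLeft true h), Shape.pt (.compLeft true h)⟩,
      ⟨3, 1, Shape.pt (.compRight true h), Shape.pt (.compVal true h)⟩]
    ⟨2, 3, Shape.pt (.compVal true h), Shape.pt (.compVal true h)⟩
    (fun E v hv => by
      have key : ∀ c₀ c₁ c₂ c₃ : E.Dom (.comp true h), c₁.1.1 = c₀.1.2 →
          c₂.1.1 = E.C.comp h c₀.1.1 c₀.1.2 c₀.2 → c₂.1.2 = c₁.1.2 → c₃.1.1 = c₀.1.1 →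
          c₃.1.2 = E.C.comp h c₁.1.1 c₁.1.2 c₁.2 →
          E.C.comp h c₂.1.1 c₂.1.2 c₂.2 = E.C.comp h c₃.1.1 c₃.1.2 c₃.2 := by
        rintro ⟨⟨z, y⟩, hzy⟩ ⟨⟨_, x⟩, hyx⟩ ⟨⟨_, _⟩, _⟩ ⟨⟨_, _⟩, _⟩ h₁ h₂ h₃ h₄ h₅
        dsimp only at h₁ h₂ h₃ h₄ h₅
        subst h₁ h₂ h₃ h₄ h₅
        exact E.C.assoc h _ _ _ hzy hyx
      exact key (v 0) (v 1) (v 2) (v 3) (hv 0) (hv 1) (hv 2) (hv 3) (hv 4))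
    (fun | 0 => zy | 1 => yx | 2 => l | 3 => r)
    (fun | 0 => h₁ | 1 => h₂ | 2 => h₃ | 3 => h₄ | 4 => h₅)

theorem one_comp {p m : ℕ} (h : p < m) (c : P.obj (.oper (.comp true h)))
    (o : P.obj (.oper (.one true h)))
    (h₁ : val (.compLeft true h) c = val (.oneVal true h) o) :
    val (.compVal true h) c = val (.compRight true h) c :=
  horn hP ![.oper (.comp true h), .oper (.one true h)]
    ![⟨0, 1, Shape.pt (.compLeft true h), Shape.pt (.oneVal true h)⟩]
    ⟨0, 0, Shape.pt (.compVal true h), Shape.pt (.compRight true h)⟩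
    (fun E v hv => by
      have key : ∀ (c : E.Dom (.comp true h)) (o : E.Dom (.one true h)),
          c.1.1 = E.C.one h o → E.C.comp h c.1.1 c.1.2 c.2 = c.1.2 := by
        rintro ⟨⟨_, x⟩, e⟩ o rfl
        -- Composability forces the unit to be the one at the target of `x`.
        obtain rfl : o = tgt h x := (E.C.src_one h o).symm.trans e
        exact E.C.one_comp h x
      exact key (v 0) (v 1) (hv 0))
    (fun | 0 => c | 1 => o) (fun | 0 => h₁)

theorem comp_one {p m : ℕ} (h : p < m) (c : P.obj (.oper (.comp true h)))
    (o : P.obj (.oper (.one true h)))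
    (h₁ : val (.compRight true h) c = val (.oneVal true h) o) :
    val (.compVal true h) c = val (.compLeft true h) c :=
  horn hP ![.oper (.comp true h), .oper (.one true h)]
    ![⟨0, 1, Shape.pt (.compRight true h), Shape.pt (.oneVal true h)⟩]
    ⟨0, 0, Shape.pt (.compVal true h), Shape.pt (.compLeft true h)⟩
    (fun E v hv => by
      have key : ∀ (c : E.Dom (.comp true h)) (o : E.Dom (.one true h)),
          c.1.2 = E.C.one h o → E.C.comp h c.1.1 c.1.2 c.2 = c.1.1 := by
        rintro ⟨⟨y, _⟩, e⟩ o rfl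
        obtain rfl : src h y = o := e.trans (E.C.tgt_one h o)
        exact E.C.comp_one h y
      exact key (v 0) (v 1) (hv 0))
    (fun | 0 => c | 1 => o) (fun | 0 => h₁)

theorem interchange {p q m : ℕ} (h : p < q) (k : q < m)
    (cy cx l : P.obj (.oper (.comp true k))) (dl dy dx : P.obj (.oper (.comp true (h.trans k))))
    (h₁ : val (.compLeft true (h.trans k)) dl = val (.compVal true k) cy)
    (h₂ : val (.compRight true (h.trans k)) dl = val (.compVal true k) cx)
    (h₃ : val (.compLeft true (h.trans k)) dy = val (.compLeft true k) cy)
    (h₄ : val (.compRight true (h.trans k)) dy = val (.compLeft true k) cx)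
    (h₅ : val (.compLeft true (h.trans k)) dx = val (.compRight true k) cy)
    (h₆ : val (.compRight true (h.trans k)) dx = val (.compRight true k) cx)
    (h₇ : val (.compLeft true k) l = val (.compVal true (h.trans k)) dy)
    (h₈ : val (.compRight true k) l = val (.compVal true (h.trans k)) dx) :
    val (.compVal true (h.trans k)) dl = val (.compVal true k) l :=
  horn hP ![.oper (.comp true k), .oper (.comp true k), .oper (.comp true k),
      .oper (.comp true (h.trans k)), .oper (.comp true (h.trans k)),
      .oper (.comp true (h.trans k))]
    ![⟨3, 0, Shape.pt (.compLeft true (h.trans k)), Shape.pt (.compVal true k)⟩,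
      ⟨3, 1, Shape.pt (.compRight true (h.trans k)), Shape.pt (.compVal true k)⟩,
      ⟨4, 0, Shape.pt (.compLeft true (h.trans k)), Shape.pt (.compLeft true k)⟩,
      ⟨4, 1, Shape.pt (.compRight true (h.trans k)), Shape.pt (.compLeft true k)⟩,
      ⟨5, 0, Shape.pt (.compLeft true (h.trans k)), Shape.pt (.compRight true k)⟩,
      ⟨5, 1, Shape.pt (.compRight true (h.trans k)), Shape.pt (.compRight true k)⟩,
      ⟨2, 4, Shape.pt (.compLeft true k), Shape.pt (.compVal true (h.trans k))⟩,
      ⟨2, 5, Shape.pt (.compRight true k), Shape.pt (.compVal true (h.trans k))⟩]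
    ⟨3, 2, Shape.pt (.compVal true (h.trans k)), Shape.pt (.compVal true k)⟩
    (fun E v hv => by
      have key : ∀ (cy cx l : E.Dom (.comp true k)) (dl dy dx : E.Dom (.comp true (h.trans k))),
          dl.1.1 = E.C.comp k cy.1.1 cy.1.2 cy.2 → dl.1.2 = E.C.comp k cx.1.1 cx.1.2 cx.2 →
          dy.1.1 = cy.1.1 → dy.1.2 = cx.1.1 → dx.1.1 = cy.1.2 → dx.1.2 = cx.1.2 →
          l.1.1 = E.C.comp (h.trans k) dy.1.1 dy.1.2 dy.2 →
          l.1.2 = E.C.comp (h.trans k) dx.1.1 dx.1.2 dx.2 →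
          E.C.comp (h.trans k) dl.1.1 dl.1.2 dl.2 = E.C.comp k l.1.1 l.1.2 l.2 := by
        rintro ⟨⟨y', y⟩, hy⟩ ⟨⟨x', x⟩, hx⟩ ⟨⟨_, _⟩, _⟩ ⟨⟨_, _⟩, _⟩ ⟨⟨_, _⟩, hyx'⟩ ⟨⟨_, _⟩, hyx⟩
          h₁ h₂ h₃ h₄ h₅ h₆ h₇ h₈
        dsimp only at h₁ h₂ h₃ h₄ h₅ h₆ h₇ h₈
        subst h₁ h₂ h₃ h₄ h₅ h₆ h₇ h₈
        exact E.C.interchange h k _ _ _ _ hy hx hyx' hyx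
      exact key (v 0) (v 1) (v 2) (v 3) (v 4) (v 5) (hv 0) (hv 1) (hv 2) (hv 3) (hv 4) (hv 5)
        (hv 6) (hv 7))
    (fun | 0 => cy | 1 => cx | 2 => l | 3 => dl | 4 => dy | 5 => dx)
    (fun | 0 => h₁ | 1 => h₂ | 2 => h₃ | 3 => h₄ | 4 => h₅ | 5 => h₆ | 6 => h₇ | 7 => h₈)

theorem one_map_comp {q p m : ℕ} (h : q < p) (k : p < m) (c : P.obj (.oper (.comp true h)))
    (d : P.obj (.oper (.comp true (h.trans k)))) (oy ox ov : P.obj (.oper (.one true k)))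
    (h₁ : val (.oneArg true k) oy = val (.compLeft true h) c)
    (h₂ : val (.oneArg true k) ox = val (.compRight true h) c)
    (h₃ : val (.oneArg true k) ov = val (.compVal true h) c)
    (h₄ : val (.compLeft true (h.trans k)) d = val (.oneVal true k) oy)
    (h₅ : val (.compRight true (h.trans k)) d = val (.oneVal true k) ox) :
    val (.oneVal true k) ov = val (.compVal true (h.trans k)) d :=
  horn hP ![.oper (.comp true h), .oper (.comp true (h.trans k)), .oper (.one true k),
      .oper (.one true k), .oper (.one true k)]
    ![⟨2, 0, Shape.pt (.oneArg true k), Shape.pt (.compLeft true h)⟩,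
      ⟨3, 0, Shape.pt (.oneArg true k), Shape.pt (.compRight true h)⟩,
      ⟨4, 0, Shape.pt (.oneArg true k), Shape.pt (.compVal true h)⟩,
      ⟨1, 2, Shape.pt (.compLeft true (h.trans k)), Shape.pt (.oneVal true k)⟩,
      ⟨1, 3, Shape.pt (.compRight true (h.trans k)), Shape.pt (.oneVal true k)⟩]
    ⟨4, 1, Shape.pt (.oneVal true k), Shape.pt (.compVal true (h.trans k))⟩
    (fun E v hv => by
      have key : ∀ (c : E.Dom (.comp true h)) (d : E.Dom (.comp true (h.trans k)))
          (oy ox ov : E.C.graph.Cell p), oy = c.1.1 → ox = c.1.2 →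
          ov = E.C.comp h c.1.1 c.1.2 c.2 → d.1.1 = E.C.one k oy → d.1.2 = E.C.one k ox →
          E.C.one k ov = E.C.comp (h.trans k) d.1.1 d.1.2 d.2 := by
        rintro ⟨⟨y, x⟩, hyx⟩ ⟨⟨_, _⟩, _⟩ _ _ _ h₁ h₂ h₃ h₄ h₅
        dsimp only at h₁ h₂ h₃ h₄ h₅
        subst h₁ h₂ h₃ h₄ h₅
        exact E.C.one_map_comp h k _ _ hyx
      exact key (v 0) (v 1) (v 2) (v 3) (v 4) (hv 0) (hv 1) (hv 2) (hv 3) (hv 4))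
    (fun | 0 => c | 1 => d | 2 => oy | 3 => ox | 4 => ov)
    (fun | 0 => h₁ | 1 => h₂ | 2 => h₃ | 3 => h₄ | 4 => h₅)

/-- On the categorical side the reversor is an inverse, so it exchanges source and target in
dimension `p` for every `m > p`. This and the next lemma supply the composability needed for
inverses in a model. -/
theorem src_revArg {p m : ℕ} (hn : n ≤ p) (h : p < m) (r : P.obj (.oper (.rev true hn h))) :
    src h (val (.revArg true hn h) r) = tgt h (val (.revVal true hn h) r) :=
  (map_ptSrc (.revArg true hn h) h r).symm.trans <| .trans
    (horn hP ![.oper (.rev true hn h)] ![]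
      ⟨0, 0, Shape.ptSrc (.revArg true hn h) h, Shape.ptTgt (.revVal true hn h) h⟩
      (fun E v _ => (E.C.isInverse_rev hn h (v 0)).choose) (fun | 0 => r) (fun c => c.elim0))
    (map_ptTgt (.revVal true hn h) h r)

theorem tgt_revArg {p m : ℕ} (hn : n ≤ p) (h : p < m) (r : P.obj (.oper (.rev true hn h))) :
    src h (val (.revVal true hn h) r) = tgt h (val (.revArg true hn h) r) :=
  (map_ptSrc (.revVal true hn h) h r).symm.trans <| .trans
    (horn hP ![.oper (.rev true hn h)] ![]
      ⟨0, 0, Shape.ptSrc (.revVal true hn h) h, Shape.ptTgt (.revArg true hn h) h⟩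
      (fun E v _ => (E.C.isInverse_rev hn h (v 0)).choose_spec.choose)
      (fun | 0 => r) (fun c => c.elim0))
    (map_ptTgt (.revArg true hn h) h r)

theorem comp_rev {p m : ℕ} (hn : n ≤ p) (h : p < m) (r : P.obj (.oper (.rev true hn h)))
    (c : P.obj (.oper (.comp true h))) (o : P.obj (.oper (.one true h)))
    (h₁ : val (.compLeft true h) c = val (.revArg true hn h) r)
    (h₂ : val (.compRight true h) c = val (.revVal true hn h) r)
    (h₃ : val (.oneArg true h) o = tgt h (val (.revArg true hn h) r)) :
    val (.compVal true h) c = val (.oneVal true h) o :=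
  horn hP ![.oper (.rev true hn h), .oper (.comp true h), .oper (.one true h)]
    ![⟨1, 0, Shape.pt (.compLeft true h), Shape.pt (.revArg true hn h)⟩,
      ⟨1, 0, Shape.pt (.compRight true h), Shape.pt (.revVal true hn h)⟩,
      ⟨2, 0, Shape.pt (.oneArg true h), Shape.ptTgt (.revArg true hn h) h⟩]
    ⟨1, 2, Shape.pt (.compVal true h), Shape.pt (.oneVal true h)⟩
    (fun E v hv => by
      have key : ∀ (r : E.C.graph.Cell m) (c : E.Dom (.comp true h)) (o : E.C.graph.Cell p),
          c.1.1 = r → c.1.2 = E.C.rev hn h r → o = tgt h r →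
          E.C.comp h c.1.1 c.1.2 c.2 = E.C.one h o := by
        rintro _ ⟨⟨r, _⟩, _⟩ _ h₁ h₂ h₃
        dsimp only at h₁ h₂ h₃
        subst h₁ h₂ h₃
        exact (E.C.isInverse_rev hn h r).choose_spec.choose_spec.1
      exact key (v 0) (v 1) (v 2) (hv 0) (hv 1) (hv 2))
    (fun | 0 => r | 1 => c | 2 => o)
    (fun | 0 => h₁ | 1 => h₂ | 2 => h₃.trans (map_ptTgt (.revArg true hn h) h r).symm)

theorem rev_comp {p m : ℕ} (hn : n ≤ p) (h : p < m) (r : P.obj (.oper (.rev true hn h)))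
    (c : P.obj (.oper (.comp true h))) (o : P.obj (.oper (.one true h)))
    (h₁ : val (.compLeft true h) c = val (.revVal true hn h) r)
    (h₂ : val (.compRight true h) c = val (.revArg true hn h) r)
    (h₃ : val (.oneArg true h) o = src h (val (.revArg true hn h) r)) :
    val (.compVal true h) c = val (.oneVal true h) o :=
  horn hP ![.oper (.rev true hn h), .oper (.comp true h), .oper (.one true h)]
    ![⟨1, 0, Shape.pt (.compLeft true h), Shape.pt (.revVal true hn h)⟩,
      ⟨1, 0, Shape.pt (.compRight true h), Shape.pt (.revArg true hn h)⟩,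
      ⟨2, 0, Shape.pt (.oneArg true h), Shape.ptSrc (.revArg true hn h) h⟩]
    ⟨1, 2, Shape.pt (.compVal true h), Shape.pt (.oneVal true h)⟩
    (fun E v hv => by
      have key : ∀ (r : E.C.graph.Cell m) (c : E.Dom (.comp true h)) (o : E.C.graph.Cell p),
          c.1.1 = E.C.rev hn h r → c.1.2 = r → o = src h r →
          E.C.comp h c.1.1 c.1.2 c.2 = E.C.one h o := by
        rintro _ ⟨⟨_, r⟩, _⟩ _ h₁ h₂ h₃
        dsimp only at h₁ h₂ h₃
        subst h₂ h₁ h₃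
        exact (E.C.isInverse_rev hn h r).choose_spec.choose_spec.2
      exact key (v 0) (v 1) (v 2) (hv 0) (hv 1) (hv 2))
    (fun | 0 => r | 1 => c | 2 => o)
    (fun | 0 => h₁ | 1 => h₂ | 2 => h₃.trans (map_ptSrc (.revArg true hn h) h r).symm)

/-! #### Equations for the projection and the brackets -/

/-- The projection is encoded as operations, one in each dimension, rather than as arrows between
cells, so its naturality is an equation that has to be transferred like the others. -/
theorem map_projVal {m p : ℕ} (θ : (op ⟨m⟩ : Globeᵒᵖ) ⟶ op ⟨p⟩) (r : P.obj (.oper (.proj m)))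
    (r' : P.obj (.oper (.proj p)))
    (h₁ : val (.projArg p) r' = (graph P false).map θ (val (.projArg m) r)) :
    (graph P true).map θ (val (.projVal m) r) = val (.projVal p) r' :=
  (map_hom_pt (.projVal m) θ r).symm.trans <|
    horn hP ![.oper (.proj m), .oper (.proj p)]
      ![⟨1, 0, Shape.pt (.projArg p), Shape.Hom.pt (.projArg m) θ⟩]
      ⟨0, 1, Shape.Hom.pt (.projVal m) θ, Shape.pt (.projVal p)⟩
      (fun E v hv => by
        have key : ∀ (x : E.M.graph.Cell m) (y : E.M.graph.Cell p), y = E.M.graph.act θ.unop x →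
            E.C.toNMagma.graph.act θ.unop (mapCell E.π.graphHom x) =
              mapCell E.π.graphHom y := by
          rintro x _ rfl
          rw [act_eq, act_eq]
          exact (NatTrans.naturality_apply E.π.graphHom θ x).symm
        exact key (v 0) (v 1) (hv 0))
      (fun | 0 => r | 1 => r')
      (fun | 0 => h₁.trans (map_hom_pt (.projArg m) θ r).symm)

theorem projVal_oneVal {p m : ℕ} (h : p < m) (o : P.obj (.oper (.one false h)))
    (o' : P.obj (.oper (.one true h))) (r : P.obj (.oper (.proj p))) (r' : P.obj (.oper (.proj m)))
    (h₁ : val (.projArg p) r = val (.oneArg false h) o)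
    (h₂ : val (.projArg m) r' = val (.oneVal false h) o)
    (h₃ : val (.oneArg true h) o' = val (.projVal p) r) :
    val (.projVal m) r' = val (.oneVal true h) o' :=
  horn hP ![.oper (.one false h), .oper (.one true h), .oper (.proj p), .oper (.proj m)]
    ![⟨2, 0, Shape.pt (.projArg p), Shape.pt (.oneArg false h)⟩,
      ⟨3, 0, Shape.pt (.projArg m), Shape.pt (.oneVal false h)⟩,
      ⟨1, 2, Shape.pt (.oneArg true h), Shape.pt (.projVal p)⟩]
    ⟨3, 1, Shape.pt (.projVal m), Shape.pt (.oneVal true h)⟩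
    (fun E v hv => by
      have key : ∀ (o : E.M.graph.Cell p) (o' : E.C.graph.Cell p) (r : E.M.graph.Cell p)
          (r' : E.M.graph.Cell m), r = o → r' = E.M.one h o → o' = mapCell E.π.graphHom r →
          mapCell E.π.graphHom r' = E.C.one h o' := by
        rintro _ _ _ _ rfl rfl rfl
        exact E.π.isInfMagmaHom.map_one h _
      exact key (v 0) (v 1) (v 2) (v 3) (hv 0) (hv 1) (hv 2))
    (fun | 0 => o | 1 => o' | 2 => r | 3 => r') (fun | 0 => h₁ | 1 => h₂ | 2 => h₃)

theorem projVal_compVal {p m : ℕ} (h : p < m) (c : P.obj (.oper (.comp false h)))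
    (c' : P.obj (.oper (.comp true h))) (y x v : P.obj (.oper (.proj m)))
    (h₁ : val (.projArg m) y = val (.compLeft false h) c)
    (h₂ : val (.projArg m) x = val (.compRight false h) c)
    (h₃ : val (.projArg m) v = val (.compVal false h) c)
    (h₄ : val (.compLeft true h) c' = val (.projVal m) y)
    (h₅ : val (.compRight true h) c' = val (.projVal m) x) :
    val (.projVal m) v = val (.compVal true h) c' :=
  horn hP ![.oper (.comp false h), .oper (.comp true h), .oper (.proj m), .oper (.proj m),
      .oper (.proj m)]
    ![⟨2, 0, Shape.pt (.projArg m), Shape.pt (.compLeft false h)⟩,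
      ⟨3, 0, Shape.pt (.projArg m), Shape.pt (.compRight false h)⟩,
      ⟨4, 0, Shape.pt (.projArg m), Shape.pt (.compVal false h)⟩,
      ⟨1, 2, Shape.pt (.compLeft true h), Shape.pt (.projVal m)⟩,
      ⟨1, 3, Shape.pt (.compRight true h), Shape.pt (.projVal m)⟩]
    ⟨4, 1, Shape.pt (.projVal m), Shape.pt (.compVal true h)⟩
    (fun E v hv => by
      have key : ∀ (c : E.Dom (.comp false h)) (c' : E.Dom (.comp true h))
          (y x v : E.M.graph.Cell m), y = c.1.1 → x = c.1.2 → v = E.M.comp h c.1.1 c.1.2 c.2 →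
          c'.1.1 = mapCell E.π.graphHom y → c'.1.2 = mapCell E.π.graphHom x →
          mapCell E.π.graphHom v = E.C.comp h c'.1.1 c'.1.2 c'.2 := by
        rintro ⟨⟨_, _⟩, hyx⟩ ⟨⟨_, _⟩, _⟩ _ _ _ h₁ h₂ h₃ h₄ h₅
        dsimp only at h₁ h₂ h₃ h₄ h₅
        subst h₁ h₂ h₃ h₄ h₅
        exact E.π.isInfMagmaHom.map_comp h _ _ hyx
      exact key (v 0) (v 1) (v 2) (v 3) (v 4) (hv 0) (hv 1) (hv 2) (hv 3) (hv 4))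
    (fun | 0 => c | 1 => c' | 2 => y | 3 => x | 4 => v)
    (fun | 0 => h₁ | 1 => h₂ | 2 => h₃ | 3 => h₄ | 4 => h₅)

theorem projVal_revVal {p m : ℕ} (hn : n ≤ p) (h : p < m) (o : P.obj (.oper (.rev false hn h)))
    (o' : P.obj (.oper (.rev true hn h))) (r r' : P.obj (.oper (.proj m)))
    (h₁ : val (.projArg m) r = val (.revArg false hn h) o)
    (h₂ : val (.projArg m) r' = val (.revVal false hn h) o)
    (h₃ : val (.revArg true hn h) o' = val (.projVal m) r) :
    val (.projVal m) r' = val (.revVal true hn h) o' :=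
  horn hP ![.oper (.rev false hn h), .oper (.rev true hn h), .oper (.proj m), .oper (.proj m)]
    ![⟨2, 0, Shape.pt (.projArg m), Shape.pt (.revArg false hn h)⟩,
      ⟨3, 0, Shape.pt (.projArg m), Shape.pt (.revVal false hn h)⟩,
      ⟨1, 2, Shape.pt (.revArg true hn h), Shape.pt (.projVal m)⟩]
    ⟨3, 1, Shape.pt (.projVal m), Shape.pt (.revVal true hn h)⟩
    (fun E v hv => by
      have key : ∀ (o : E.M.graph.Cell m) (o' : E.C.graph.Cell m) (r r' : E.M.graph.Cell m),
          r = o → r' = E.M.rev hn h o → o' = mapCell E.π.graphHom r →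
          mapCell E.π.graphHom r' = E.C.rev hn h o' := by
        rintro _ _ _ _ rfl rfl rfl
        exact E.π.map_rev hn h _
      exact key (v 0) (v 1) (v 2) (v 3) (hv 0) (hv 1) (hv 2))
    (fun | 0 => o | 1 => o' | 2 => r | 3 => r') (fun | 0 => h₁ | 1 => h₂ | 2 => h₃)

theorem tgt_bracketVal {m : ℕ} (r : P.obj (.oper (.bracket m))) :
    tgt m.lt_succ_self (val (.bracketVal m) r) = val (.bracketTgt m) r :=
  (map_ptTgt (.bracketVal m) m.lt_succ_self r).symm.trans <|
    horn hP ![.oper (.bracket m)] ![]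
      ⟨0, 0, Shape.ptTgt (.bracketVal m) m.lt_succ_self, Shape.pt (.bracketTgt m)⟩
      (fun E v _ => E.tgt_bracket _ _ (show E.Dom (.bracket m) from v 0).2.1
        (show E.Dom (.bracket m) from v 0).2.2)
      (fun | 0 => r) (fun c => c.elim0)

theorem src_bracketVal {m : ℕ} (r : P.obj (.oper (.bracket m))) :
    src m.lt_succ_self (val (.bracketVal m) r) = val (.bracketSrc m) r :=
  (map_ptSrc (.bracketVal m) m.lt_succ_self r).symm.trans <|
    horn hP ![.oper (.bracket m)] ![]
      ⟨0, 0, Shape.ptSrc (.bracketVal m) m.lt_succ_self, Shape.pt (.bracketSrc m)⟩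
      (fun E v _ => E.src_bracket _ _ (show E.Dom (.bracket m) from v 0).2.1
        (show E.Dom (.bracket m) from v 0).2.2)
      (fun | 0 => r) (fun c => c.elim0)

/-- The two arguments are the target and the source of the value of the bracket, hence parallel by
the globular identities. -/
theorem parallel_bracket {m : ℕ} (r : P.obj (.oper (.bracket m))) :
    Parallel (X := graph P false) (m := m) (val (.bracketTgt m) r) (val (.bracketSrc m) r) := by
  intro p hp
  have h : p < m := hp ▸ p.lt_succ_self
  have key : ∀ x : (graph P false).Cell (m + 1),
      src h (tgt m.lt_succ_self x) = src h (src m.lt_succ_self x) ∧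
        tgt h (tgt m.lt_succ_self x) = tgt h (src m.lt_succ_self x) := fun x =>
    ⟨(src_tgt h _ x).trans (src_src h _ x).symm, (tgt_tgt h _ x).trans (tgt_src h _ x).symm⟩
  obtain ⟨h₁, h₂⟩ := key (val (.bracketVal m) r)
  have e₁ := tgt_bracketVal hP r
  have e₂ := src_bracketVal hP r
  exact ⟨(congrArg _ e₁).symm.trans (h₁.trans (congrArg _ e₂)),
    (congrArg _ e₁).symm.trans (h₂.trans (congrArg _ e₂))⟩

theorem projVal_bracket {m : ℕ} (r : P.obj (.oper (.bracket m))) (s₁ s₀ : P.obj (.oper (.proj m)))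
    (h₁ : val (.projArg m) s₁ = val (.bracketTgt m) r)
    (h₀ : val (.projArg m) s₀ = val (.bracketSrc m) r) :
    val (.projVal m) s₁ = val (.projVal m) s₀ :=
  horn hP ![.oper (.bracket m), .oper (.proj m), .oper (.proj m)]
    ![⟨1, 0, Shape.pt (.projArg m), Shape.pt (.bracketTgt m)⟩,
      ⟨2, 0, Shape.pt (.projArg m), Shape.pt (.bracketSrc m)⟩]
    ⟨1, 2, Shape.pt (.projVal m), Shape.pt (.projVal m)⟩
    (fun E v hv => by
      have key : ∀ (c : E.Dom (.bracket m)) (s₁ s₀ : E.M.graph.Cell m), s₁ = c.1.1 →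
          s₀ = c.1.2 → mapCell E.π.graphHom s₁ = mapCell E.π.graphHom s₀ := by
        rintro c _ _ rfl rfl
        exact c.2.2
      exact key (v 0) (v 1) (v 2) (hv 0) (hv 1))
    (fun | 0 => r | 1 => s₁ | 2 => s₀) (fun | 0 => h₁ | 1 => h₀)

theorem projVal_bracketVal {m : ℕ} (r : P.obj (.oper (.bracket m))) (s : P.obj (.oper (.proj m)))
    (s' : P.obj (.oper (.proj (m + 1)))) (o : P.obj (.oper (.one true m.lt_succ_self)))
    (h₁ : val (.projArg m) s = val (.bracketTgt m) r)
    (h₂ : val (.projArg (m + 1)) s' = val (.bracketVal m) r)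
    (h₃ : val (.oneArg true m.lt_succ_self) o = val (.projVal m) s) :
    val (.projVal (m + 1)) s' = val (.oneVal true m.lt_succ_self) o :=
  horn hP ![.oper (.bracket m), .oper (.proj m), .oper (.proj (m + 1)),
      .oper (.one true m.lt_succ_self)]
    ![⟨1, 0, Shape.pt (.projArg m), Shape.pt (.bracketTgt m)⟩,
      ⟨2, 0, Shape.pt (.projArg (m + 1)), Shape.pt (.bracketVal m)⟩,
      ⟨3, 1, Shape.pt (.oneArg true m.lt_succ_self), Shape.pt (.projVal m)⟩]
    ⟨2, 3, Shape.pt (.projVal (m + 1)), Shape.pt (.oneVal true m.lt_succ_self)⟩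
    (fun E v hv => by
      have key : ∀ (c : E.Dom (.bracket m)) (s : E.M.graph.Cell m) (s' : E.M.graph.Cell (m + 1))
          (o : E.C.graph.Cell m), s = c.1.1 → s' = E.bracket c.1.1 c.1.2 c.2.1 c.2.2 →
          o = mapCell E.π.graphHom s → mapCell E.π.graphHom s' = E.C.one m.lt_succ_self o := by
        rintro c _ _ _ rfl rfl rfl
        exact E.π_bracket _ _ _ _
      exact key (v 0) (v 1) (v 2) (v 3) (hv 0) (hv 1) (hv 2))
    (fun | 0 => r | 1 => s | 2 => s' | 3 => o) (fun | 0 => h₁ | 1 => h₂ | 2 => h₃)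

theorem bracketVal_self {m : ℕ} (r : P.obj (.oper (.bracket m)))
    (o : P.obj (.oper (.one false m.lt_succ_self)))
    (h₁ : val (.bracketTgt m) r = val (.oneArg false m.lt_succ_self) o)
    (h₀ : val (.bracketSrc m) r = val (.oneArg false m.lt_succ_self) o) :
    val (.bracketVal m) r = val (.oneVal false m.lt_succ_self) o :=
  horn hP ![.oper (.bracket m), .oper (.one false m.lt_succ_self)]
    ![⟨0, 1, Shape.pt (.bracketTgt m), Shape.pt (.oneArg false m.lt_succ_self)⟩,
      ⟨0, 1, Shape.pt (.bracketSrc m), Shape.pt (.oneArg false m.lt_succ_self)⟩]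
    ⟨0, 1, Shape.pt (.bracketVal m), Shape.pt (.oneVal false m.lt_succ_self)⟩
    (fun E v hv => by
      have key : ∀ (c : E.Dom (.bracket m)) (o : E.M.graph.Cell m), c.1.1 = o → c.1.2 = o →
          E.bracket c.1.1 c.1.2 c.2.1 c.2.2 = E.M.one m.lt_succ_self o := by
        rintro ⟨⟨_, _⟩, _, _⟩ o h₁ h₂
        dsimp only at h₁ h₂
        subst h₁ h₂
        exact E.bracket_self _ _ _
      exact key (v 0) (v 1) (hv 0) (hv 1))
    (fun | 0 => r | 1 => o) (fun | 0 => h₁ | 1 => h₀)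

/-! #### Existence and uniqueness of the elements of operations with given arguments -/

theorem existsUnique_cells {k : ℕ} (d : Fin k → Shape n) {m : ℕ} (hyp : Fin m → Equation d)
    (r : Shape n) (f : ∀ c, r ⟶ d c)
    (H : ∀ (E : Stretching.{u} n) (v : ∀ i, E.nerve.obj (d i)), (∀ c, (hyp c).Holds v) →
      ∃! x : E.nerve.obj r, ∀ c, E.nerve.map (f c) x = v c)
    (v : ∀ i, P.obj (d i)) (hv : ∀ c, (hyp c).Holds v) :
    ∃! x : P.obj r, ∀ c, P.map (f c) x = v c := by
  have := existsUnique hP d hyp r f (fun c => 𝟙 (d c)) (fun E w hw => by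
    simpa only [Functor.map_id_apply] using H E w hw) v hv
  simpa only [Functor.map_id_apply] using this

theorem existsUnique_one {p m : ℕ} (h : p < m) (x : (graph P b).Cell p) :
    ∃! r : P.obj (.oper (.one b h)), val (.oneArg b h) r = x := by
  have := existsUnique_cells hP ![.cell b (op ⟨p⟩)] ![] (.oper (.one b h))
    (fun | 0 => Shape.pt (.oneArg b h))
    (fun E v _ => ⟨v 0, fun | 0 => rfl, fun y hy => hy 0⟩) (fun | 0 => x) (fun c => c.elim0)
  simp only [Fin.forall_fin_one] at this
  exact this

theorem existsUnique_rev {p m : ℕ} (hn : n ≤ p) (h : p < m) (x : (graph P b).Cell m) :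
    ∃! r : P.obj (.oper (.rev b hn h)), val (.revArg b hn h) r = x := by
  have := existsUnique_cells hP ![.cell b (op ⟨m⟩)] ![] (.oper (.rev b hn h))
    (fun | 0 => Shape.pt (.revArg b hn h))
    (fun E v _ => ⟨v 0, fun | 0 => rfl, fun y hy => hy 0⟩) (fun | 0 => x) (fun c => c.elim0)
  simp only [Fin.forall_fin_one] at this
  exact this

theorem existsUnique_proj {m : ℕ} (x : (graph P false).Cell m) :
    ∃! r : P.obj (.oper (.proj m)), val (.projArg m) r = x := by
  have := existsUnique_cells hP ![.cell false (op ⟨m⟩)] ![] (.oper (.proj m))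
    (fun | 0 => Shape.pt (.projArg m))
    (fun E v _ => ⟨v 0, fun | 0 => rfl, fun y hy => hy 0⟩) (fun | 0 => x) (fun c => c.elim0)
  simp only [Fin.forall_fin_one] at this
  exact this

theorem existsUnique_comp {p m : ℕ} (h : p < m) (y x : (graph P b).Cell m)
    (hyx : src h y = tgt h x) :
    ∃! r : P.obj (.oper (.comp b h)), val (.compLeft b h) r = y ∧ val (.compRight b h) r = x := by
  have := existsUnique_cells hP ![.cell b (op ⟨m⟩), .cell b (op ⟨m⟩)]
    ![⟨0, 1, Shape.mapCell b (Globe.s h).op, Shape.mapCell b (Globe.t h).op⟩] (.oper (.comp b h))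
    (fun | 0 => Shape.pt (.compLeft b h) | 1 => Shape.pt (.compRight b h))
    (fun E v hv => ⟨(⟨(v 0, v 1), hv 0⟩ : E.Dom (.comp b h)), fun | 0 => rfl | 1 => rfl,
      fun y hy => Subtype.ext (Prod.ext (hy 0) (hy 1))⟩)
    (fun | 0 => y | 1 => x) (fun | 0 => hyx)
  simp only [Fin.forall_fin_two] at this
  exact this

/-- The variables are elements of the projection rather than cells: equality of the projections can
only be expressed through their values. -/
theorem existsUnique_bracket {m : ℕ} (r₁ r₀ : P.obj (.oper (.proj m)))
    (hpar : Parallel (X := graph P false) (val (.projArg m) r₁) (val (.projArg m) r₀))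
    (hv : val (.projVal m) r₁ = val (.projVal m) r₀) :
    ∃! r : P.obj (.oper (.bracket m)), val (.bracketTgt m) r = val (.projArg m) r₁ ∧
      val (.bracketSrc m) r = val (.projArg m) r₀ := by
  -- For `0`-cells parallelism is void, so the sequent has a single hypothesis; in positive
  -- dimension there are two more, for source and target.
  cases m with
  | zero =>
    have := existsUnique hP ![.oper (.proj 0), .oper (.proj 0)]
      ![⟨0, 1, Shape.pt (.projVal 0), Shape.pt (.projVal 0)⟩] (.oper (.bracket 0))
      (e := fun _ => .cell false (op ⟨0⟩))
      (fun | 0 => Shape.pt (.bracketTgt 0) | 1 => Shape.pt (.bracketSrc 0))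
      (fun | 0 => Shape.pt (.projArg 0) | 1 => Shape.pt (.projArg 0))
      (fun E v hv => ⟨(⟨(v 0, v 1), fun p hp => absurd hp p.succ_ne_zero, hv 0⟩ :
          E.Dom (.bracket 0)), fun | 0 => rfl | 1 => rfl,
        fun y hy => Subtype.ext (Prod.ext (hy 0) (hy 1))⟩)
      (fun | 0 => r₁ | 1 => r₀) (fun | 0 => hv)
    simp only [Fin.forall_fin_two] at this
    exact this
  | succ m =>
    have := existsUnique hP ![.oper (.proj (m + 1)), .oper (.proj (m + 1))]
      ![⟨0, 1, Shape.pt (.projVal (m + 1)), Shape.pt (.projVal (m + 1))⟩,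
        ⟨0, 1, Shape.ptSrc (.projArg (m + 1)) m.lt_succ_self,
          Shape.ptSrc (.projArg (m + 1)) m.lt_succ_self⟩,
        ⟨0, 1, Shape.ptTgt (.projArg (m + 1)) m.lt_succ_self,
          Shape.ptTgt (.projArg (m + 1)) m.lt_succ_self⟩] (.oper (.bracket (m + 1)))
      (e := fun _ => .cell false (op ⟨m + 1⟩))
      (fun | 0 => Shape.pt (.bracketTgt (m + 1)) | 1 => Shape.pt (.bracketSrc (m + 1)))
      (fun | 0 => Shape.pt (.projArg (m + 1)) | 1 => Shape.pt (.projArg (m + 1)))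
      (fun E v hv => ⟨(⟨(v 0, v 1), fun p hp => by
          obtain rfl : p = m := Nat.succ_injective hp
          exact ⟨hv 1, hv 2⟩, hv 0⟩ : E.Dom (.bracket (m + 1))), fun | 0 => rfl | 1 => rfl,
        fun y hy => Subtype.ext (Prod.ext (hy 0) (hy 1))⟩)
      (fun | 0 => r₁ | 1 => r₀)
      (fun
        | 0 => hv
        | 1 => (map_ptSrc (.projArg (m + 1)) m.lt_succ_self r₁).trans
            ((hpar m rfl).1.trans (map_ptSrc (.projArg (m + 1)) m.lt_succ_self r₀).symm)
        | 2 => (map_ptTgt (.projArg (m + 1)) m.lt_succ_self r₁).trans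
            ((hpar m rfl).2.trans (map_ptTgt (.projArg (m + 1)) m.lt_succ_self r₀).symm))
    simp only [Fin.forall_fin_two] at this
    exact this

/-! #### The elements of operations with given arguments -/

/-- The element of a reflexor with a given argument. -/
noncomputable def oneOp (b : Bool) {p m : ℕ} (h : p < m) (x : (graph P b).Cell p) :
    P.obj (.oper (.one b h)) :=
  (existsUnique_one hP b h x).choose

theorem oneArg_oneOp (b : Bool) {p m : ℕ} (h : p < m) (x : (graph P b).Cell p) :
    val (.oneArg b h) (oneOp hP b h x) = x :=
  (existsUnique_one hP b h x).choose_spec.1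

/-- The element of a reversor with a given argument. -/
noncomputable def revOp (b : Bool) {p m : ℕ} (hn : n ≤ p) (h : p < m) (x : (graph P b).Cell m) :
    P.obj (.oper (.rev b hn h)) :=
  (existsUnique_rev hP b hn h x).choose

theorem revArg_revOp (b : Bool) {p m : ℕ} (hn : n ≤ p) (h : p < m) (x : (graph P b).Cell m) :
    val (.revArg b hn h) (revOp hP b hn h x) = x :=
  (existsUnique_rev hP b hn h x).choose_spec.1

/-- The element of the projection with a given argument. -/
noncomputable def projOp {m : ℕ} (x : (graph P false).Cell m) : P.obj (.oper (.proj m)) :=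
  (existsUnique_proj hP x).choose

theorem projArg_projOp {m : ℕ} (x : (graph P false).Cell m) :
    val (.projArg m) (projOp hP x) = x :=
  (existsUnique_proj hP x).choose_spec.1

/-- The element of a composition with given arguments. -/
noncomputable def compOp (b : Bool) {p m : ℕ} (h : p < m) (y x : (graph P b).Cell m)
    (hyx : src h y = tgt h x) : P.obj (.oper (.comp b h)) :=
  (existsUnique_comp hP b h y x hyx).choose

theorem compLeft_compOp (b : Bool) {p m : ℕ} (h : p < m) (y x : (graph P b).Cell m)
    (hyx : src h y = tgt h x) : val (.compLeft b h) (compOp hP b h y x hyx) = y :=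
  (existsUnique_comp hP b h y x hyx).choose_spec.1.1

theorem compRight_compOp (b : Bool) {p m : ℕ} (h : p < m) (y x : (graph P b).Cell m)
    (hyx : src h y = tgt h x) : val (.compRight b h) (compOp hP b h y x hyx) = x :=
  (existsUnique_comp hP b h y x hyx).choose_spec.1.2

/-- The image of a cell under the projection. -/
noncomputable def projCell {m : ℕ} (x : (graph P false).Cell m) : (graph P true).Cell m :=
  val (.projVal m) (projOp hP x)

/-- Uniqueness of the element with a given argument makes the value a function of the argument. The
analogues for the other operations below hold for the same reason. -/
theorem projVal_eq {m : ℕ} (r : P.obj (.oper (.proj m))) :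
    val (.projVal m) r = projCell hP (val (.projArg m) r) :=
  congrArg _ ((existsUnique_proj hP _).unique rfl (projArg_projOp hP _))

theorem existsUnique_bracketOp {m : ℕ} (c₁ c₀ : (graph P false).Cell m) (hpar : Parallel c₁ c₀)
    (hπ : projCell hP c₁ = projCell hP c₀) :
    ∃! r : P.obj (.oper (.bracket m)),
      val (.bracketTgt m) r = c₁ ∧ val (.bracketSrc m) r = c₀ := by
  have e₁ := projArg_projOp hP c₁
  have e₀ := projArg_projOp hP c₀
  have := existsUnique_bracket hP (projOp hP c₁) (projOp hP c₀) (by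
    rw [e₁, e₀]
    exact hpar) hπ
  rwa [e₁, e₀] at this

/-- The element of a bracket with given arguments. -/
noncomputable def bracketOp {m : ℕ} (c₁ c₀ : (graph P false).Cell m) (hpar : Parallel c₁ c₀)
    (hπ : projCell hP c₁ = projCell hP c₀) : P.obj (.oper (.bracket m)) :=
  (existsUnique_bracketOp hP c₁ c₀ hpar hπ).choose

theorem bracketTgt_bracketOp {m : ℕ} (c₁ c₀ : (graph P false).Cell m) (hpar : Parallel c₁ c₀)
    (hπ : projCell hP c₁ = projCell hP c₀) :
    val (.bracketTgt m) (bracketOp hP c₁ c₀ hpar hπ) = c₁ :=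
  (existsUnique_bracketOp hP c₁ c₀ hpar hπ).choose_spec.1.1

theorem bracketSrc_bracketOp {m : ℕ} (c₁ c₀ : (graph P false).Cell m) (hpar : Parallel c₁ c₀)
    (hπ : projCell hP c₁ = projCell hP c₀) :
    val (.bracketSrc m) (bracketOp hP c₁ c₀ hpar hπ) = c₀ :=
  (existsUnique_bracketOp hP c₁ c₀ hpar hπ).choose_spec.1.2

/-! #### The stretching of a model -/

/-- The ∞-magma on one side of a model. -/
noncomputable def magma (b : Bool) : InfMagma.{u} where
  graph := graph P b
  one h x := val (.oneVal b h) (oneOp hP b h x)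
  one_one h k x := oneVal_oneVal hP b h k _ _ _ (oneArg_oneOp hP b k _)
    ((oneArg_oneOp hP b _ x).trans (oneArg_oneOp hP b h x).symm)
  src_one h x := (src_oneVal hP b h _).trans (oneArg_oneOp hP b h x)
  tgt_one h x := (tgt_oneVal hP b h _).trans (oneArg_oneOp hP b h x)
  comp h y x hyx := val (.compVal b h) (compOp hP b h y x hyx)
  src_comp_of_lt h k y x hyx := src_compVal_of_lt hP b h k _ _
    ((compLeft_compOp hP b h _ _ _).trans (congrArg _ (compLeft_compOp hP b _ y x hyx).symm))
    ((compRight_compOp hP b h _ _ _).trans (congrArg _ (compRight_compOp hP b _ y x hyx).symm))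
  tgt_comp_of_lt h k y x hyx := tgt_compVal_of_lt hP b h k _ _
    ((compLeft_compOp hP b h _ _ _).trans (congrArg _ (compLeft_compOp hP b _ y x hyx).symm))
    ((compRight_compOp hP b h _ _ _).trans (congrArg _ (compRight_compOp hP b _ y x hyx).symm))
  src_comp_of_le h k y x hyx := (src_compVal hP b h k _).trans
    (congrArg _ (compRight_compOp hP b k y x hyx))
  tgt_comp_of_le h k y x hyx := (tgt_compVal hP b h k _).trans
    (congrArg _ (compLeft_compOp hP b k y x hyx))

theorem oneVal_eq (b : Bool) {p m : ℕ} (h : p < m) (r : P.obj (.oper (.one b h))) :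
    val (.oneVal b h) r = (magma hP b).one h (val (.oneArg b h) r) :=
  congrArg _ ((existsUnique_one hP b h _).unique rfl (oneArg_oneOp hP b h _))

theorem compVal_eq (b : Bool) {p m : ℕ} (h : p < m) (r : P.obj (.oper (.comp b h))) :
    val (.compVal b h) r = (magma hP b).comp h (val (.compLeft b h) r) (val (.compRight b h) r)
      (src_compLeft hP b h r) :=
  congrArg _ ((existsUnique_comp hP b h _ _ (src_compLeft hP b h r)).unique ⟨rfl, rfl⟩
    ⟨compLeft_compOp hP b h _ _ _, compRight_compOp hP b h _ _ _⟩)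

/-- The (∞,n)-magma on one side of a model. -/
noncomputable def nMagma (b : Bool) : NMagma.{u} n where
  toInfMagma := magma hP b
  rev hn h x := val (.revVal b hn h) (revOp hP b hn h x)
  src_rev_succ hn x := (src_revVal_succ hP b hn _).trans (congrArg _ (revArg_revOp hP b hn _ x))
  tgt_rev_succ hn x := (tgt_revVal_succ hP b hn _).trans (congrArg _ (revArg_revOp hP b hn _ x))
  src_rev hn h x := src_revVal hP b hn h _ _ ((revArg_revOp hP b hn h _).trans
    (congrArg _ (revArg_revOp hP b hn _ x).symm))
  tgt_rev hn h x := tgt_revVal hP b hn h _ _ ((revArg_revOp hP b hn h _).trans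
    (congrArg _ (revArg_revOp hP b hn _ x).symm))

theorem revVal_eq (b : Bool) {p m : ℕ} (hn : n ≤ p) (h : p < m) (r : P.obj (.oper (.rev b hn h))) :
    val (.revVal b hn h) r = (nMagma hP b).rev hn h (val (.revArg b hn h) r) :=
  congrArg _ ((existsUnique_rev hP b hn h _).unique rfl (revArg_revOp hP b hn h _))

/-- The strict (∞,n)-category of a model. -/
noncomputable def cat : StrictNCat.{u} n where
  toInfMagma := magma hP true
  assoc h z y x hzy hyx := assoc hP h (compOp hP true h z y hzy) (compOp hP true h y x hyx) _ _
    ((compLeft_compOp hP true h _ _ _).trans (compRight_compOp hP true h _ _ _).symm)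
    (compLeft_compOp hP true h _ _ _)
    ((compRight_compOp hP true h _ _ _).trans (compRight_compOp hP true h _ _ _).symm)
    ((compLeft_compOp hP true h _ _ _).trans (compLeft_compOp hP true h _ _ _).symm)
    (compRight_compOp hP true h _ _ _)
  one_comp h x := (one_comp hP h _ (oneOp hP true h (tgt h x))
    (compLeft_compOp hP true h _ _ _)).trans (compRight_compOp hP true h _ _ _)
  comp_one h y := (comp_one hP h _ (oneOp hP true h (src h y))
    (compRight_compOp hP true h _ _ _)).trans (compLeft_compOp hP true h _ _ _)
  interchange h k y' y x' x hy hx hyx' hyx :=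
    interchange hP h k (compOp hP true k y' y hy) (compOp hP true k x' x hx) _ _
      (compOp hP true (h.trans k) y' x' hyx') (compOp hP true (h.trans k) y x hyx)
      (compLeft_compOp hP true _ _ _ _) (compRight_compOp hP true _ _ _ _)
      ((compLeft_compOp hP true _ _ _ _).trans (compLeft_compOp hP true _ _ _ _).symm)
      ((compRight_compOp hP true _ _ _ _).trans (compLeft_compOp hP true _ _ _ _).symm)
      ((compLeft_compOp hP true _ _ _ _).trans (compRight_compOp hP true _ _ _ _).symm)
      ((compRight_compOp hP true _ _ _ _).trans (compRight_compOp hP true _ _ _ _).symm)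
      (compLeft_compOp hP true _ _ _ _) (compRight_compOp hP true _ _ _ _)
  one_map_comp h k y x hyx :=
    one_map_comp hP h k (compOp hP true h y x hyx) _ (oneOp hP true k y) (oneOp hP true k x) _
      ((oneArg_oneOp hP true _ _).trans (compLeft_compOp hP true _ _ _ _).symm)
      ((oneArg_oneOp hP true _ _).trans (compRight_compOp hP true _ _ _ _).symm)
      (oneArg_oneOp hP true _ _)
      (compLeft_compOp hP true _ _ _ _) (compRight_compOp hP true _ _ _ _)
  exists_inverse hn h α := by
    have e := revArg_revOp hP true hn h α
    have e₁ := src_revArg hP hn h (revOp hP true hn h α)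
    have e₂ := tgt_revArg hP hn h (revOp hP true hn h α)
    refine ⟨val (.revVal true hn h) (revOp hP true hn h α), (congrArg (src h) e).symm.trans e₁,
      e₂.trans (congrArg (tgt h) e), ?_, ?_⟩
    · exact comp_rev hP hn h (revOp hP true hn h α) _ _
        ((compLeft_compOp hP true h _ _ _).trans e.symm) (compRight_compOp hP true h _ _ _)
        ((oneArg_oneOp hP true h _).trans (congrArg (tgt h) e).symm)
    · exact rev_comp hP hn h (revOp hP true hn h α) _ _
        (compLeft_compOp hP true h _ _ _) ((compRight_compOp hP true h _ _ _).trans e.symm)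
        ((oneArg_oneOp hP true h _).trans (congrArg (src h) e).symm)

/-- The canonical reversors of `cat` come from a choice of inverses and those of `nMagma` from the
values in the model. Both are inverses, so they agree by uniqueness, though not by definition. -/
theorem cat_rev {p m : ℕ} (hn : n ≤ p) (h : p < m) (α : (graph P true).Cell m) :
    (nMagma hP true).rev hn h α = (cat hP).rev hn h α := by
  refine (cat hP).inverse_unique h ?_ ((cat hP).isInverse_rev hn h α)
  have e := revArg_revOp hP true hn h α
  have e₁ := src_revArg hP hn h (revOp hP true hn h α)
  have e₂ := tgt_revArg hP hn h (revOp hP true hn h α)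
  refine ⟨(congrArg (src h) e).symm.trans e₁, e₂.trans (congrArg (tgt h) e), ?_, ?_⟩
  · exact comp_rev hP hn h (revOp hP true hn h α) _ _
      ((compLeft_compOp hP true h _ _ _).trans e.symm) (compRight_compOp hP true h _ _ _)
      ((oneArg_oneOp hP true h _).trans (congrArg (tgt h) e).symm)
  · exact rev_comp hP hn h (revOp hP true hn h α) _ _
      (compLeft_compOp hP true h _ _ _) ((compRight_compOp hP true h _ _ _).trans e.symm)
      ((oneArg_oneOp hP true h _).trans (congrArg (src h) e).symm)

/-- The projection of a model. -/
noncomputable def projHom : NMagma.Hom (nMagma hP false) (cat hP).toNMagma where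
  graphHom :=
    { app := fun e => ↾(fun x => projCell hP (m := e.unop.dim) x)
      naturality := fun e e' θ => by
        ext x
        exact (map_projVal hP (m := e.unop.dim) (p := e'.unop.dim) θ _ _
          ((projArg_projOp hP _).trans
            (congrArg ((graph P false).map θ) (projArg_projOp hP (m := e.unop.dim) x).symm))).symm }
  isInfMagmaHom :=
    { map_one := fun h x => projVal_oneVal hP h (oneOp hP false h x) _ (projOp hP x) _
        ((projArg_projOp hP _).trans (oneArg_oneOp hP false h x).symm)
        (projArg_projOp hP _) (oneArg_oneOp hP true h _)
      map_comp := fun h y x hyx => projVal_compVal hP h (compOp hP false h y x hyx) _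
        (projOp hP y) (projOp hP x) _
        ((projArg_projOp hP _).trans (compLeft_compOp hP false h y x hyx).symm)
        ((projArg_projOp hP _).trans (compRight_compOp hP false h y x hyx).symm)
        (projArg_projOp hP _) (compLeft_compOp hP true h _ _ _)
        (compRight_compOp hP true h _ _ _) }
  map_rev hn h x := .trans
    (projVal_revVal hP hn h (revOp hP false hn h x) _ (projOp hP x) _
      ((projArg_projOp hP _).trans (revArg_revOp hP false hn h x).symm)
      (projArg_projOp hP _) (revArg_revOp hP true hn h _))
    (cat_rev hP hn h _)

/-- The stretching of a model. -/
noncomputable def stretching : Stretching.{u} n where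
  M := nMagma hP false
  C := cat hP
  π := projHom hP
  bracket {m} c₁ c₀ hpar hπ := val (.bracketVal m) (bracketOp hP c₁ c₀ hpar hπ)
  tgt_bracket c₁ c₀ hpar hπ := (tgt_bracketVal hP _).trans (bracketTgt_bracketOp hP c₁ c₀ hpar hπ)
  src_bracket c₁ c₀ hpar hπ := (src_bracketVal hP _).trans (bracketSrc_bracketOp hP c₁ c₀ hpar hπ)
  π_bracket c₁ c₀ hpar hπ := projVal_bracketVal hP _ (projOp hP c₁) _ _
    ((projArg_projOp hP _).trans (bracketTgt_bracketOp hP c₁ c₀ hpar hπ).symm)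
    (projArg_projOp hP _) (oneArg_oneOp hP true _ _)
  bracket_self c hpar hπ := bracketVal_self hP _ _
    ((bracketTgt_bracketOp hP c c hpar hπ).trans (oneArg_oneOp hP false _ c).symm)
    ((bracketSrc_bracketOp hP c c hpar hπ).trans (oneArg_oneOp hP false _ c).symm)

/-! #### The nerve of the stretching of a model -/

/-- The cells of a model are the cells of its stretching. -/
noncomputable def cellIso : (b : Bool) → graph P b ≅ ((stretching hP).side b).graph
  | false => Iso.refl _
  | true => Iso.refl _

theorem projCell_bracket {m : ℕ} (r : P.obj (.oper (.bracket m))) :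
    projCell hP (val (.bracketTgt m) r) = projCell hP (val (.bracketSrc m) r) :=
  projVal_bracket hP r _ _ (projArg_projOp hP _) (projArg_projOp hP _)

/-- The comparison of the elements of the operations. -/
noncomputable def toDom : (r : Oper n) → P.obj (.oper r) → (stretching hP).Dom r
  | .one b h, x => mapCell (cellIso hP b).hom (val (.oneArg b h) x)
  | .comp b h, x => ⟨(mapCell (cellIso hP b).hom (val (.compLeft b h) x),
      mapCell (cellIso hP b).hom (val (.compRight b h) x)), by
        rw [← mapCell_src, ← mapCell_tgt]
        exact congrArg _ (src_compLeft hP b h x)⟩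
  | .rev b hn h, x => mapCell (cellIso hP b).hom (val (.revArg b hn h) x)
  | .proj m, x => val (.projArg m) x
  | .bracket m, x => ⟨(val (.bracketTgt m) x, val (.bracketSrc m) x), parallel_bracket hP x,
      projCell_bracket hP x⟩

/-- Arguments match by definition; values match because an element of an operation is the chosen one
with its arguments. -/
theorem point_toDom {r : Oper n} (i : Pt r) (x : P.obj (.oper r)) :
    (stretching hP).point i (toDom hP r x) = mapCell (cellIso hP i.side).hom (val i x) := by
  cases i with
  | oneArg b h => rfl
  | oneVal b h => cases b <;> exact (oneVal_eq hP _ h x).symm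
  | compLeft b h => rfl
  | compRight b h => rfl
  | compVal b h => cases b <;> exact (compVal_eq hP _ h x).symm
  | revArg b hn h => rfl
  | revVal b hn h =>
    cases b
    · exact (revVal_eq hP _ hn h x).symm
    -- On the categorical side the reversor of the stretching is the chosen inverse, hence the extra
    -- comparison.
    · exact ((revVal_eq hP _ hn h x).trans (cat_rev hP hn h _)).symm
  | projArg m => rfl
  | projVal m => exact (projVal_eq hP x).symm
  | bracketTgt m => rfl
  | bracketSrc m => rfl
  | bracketVal m =>
    exact (congrArg (val (.bracketVal m)) ((existsUnique_bracketOp hP _ _ (parallel_bracket hP x)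
      (projCell_bracket hP x)).unique ⟨rfl, rfl⟩
        ⟨bracketTgt_bracketOp hP _ _ _ _, bracketSrc_bracketOp hP _ _ _ _⟩)).symm

/-- The components of the comparison of a model with the nerve of its stretching. -/
noncomputable def toNerveApp : (X : Shape n) → P.obj X → (stretching hP).NerveObj X
  | .cell b e => (cellIso hP b).hom.app e
  | .oper r => toDom hP r

/-- The comparison of a model with the nerve of its stretching. -/
noncomputable def toNerve : P ⟶ (stretching hP).nerve where
  app X := ↾(toNerveApp hP X)
  naturality X Y g := by
    ext x
    change Shape.Hom _ _ at g
    cases g with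
    | cell b θ => exact NatTrans.naturality_apply (cellIso hP b).hom θ x
    | id r => exact congrArg (toDom hP r) congr($(P.map_id _) x)
    | pt i θ =>
      change mapCell (cellIso hP i.side).hom (P.map (Shape.Hom.pt i θ) x) =
        ((stretching hP).side i.side).graph.act θ.unop
          ((stretching hP).point i (toDom hP _ x))
      rw [act_eq, point_toDom]
      exact (congrArg _ (map_hom_pt i θ x)).trans
        (NatTrans.naturality_apply (cellIso hP i.side).hom θ _)

/-- The map is the identity on each side, but the two sets of cells coincide by definition only once
`b` is `false` or `true`. -/
theorem mapCell_cellIso_bijective (b : Bool) (m : ℕ) :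
    Function.Bijective (fun x : (graph P b).Cell m => mapCell (cellIso hP b).hom x) := by
  cases b <;> exact Function.bijective_id

/-- This is the transferred unique existence of an element over each admissible tuple of arguments.
-/
theorem toDom_bijective (r : Oper n) : Function.Bijective (toDom hP r) := by
  cases r with
  | one b h =>
    exact (mapCell_cellIso_bijective hP b _).comp
      (Function.bijective_iff_existsUnique _ |>.2 (existsUnique_one hP b h))
  | comp b h =>
    have hb := mapCell_cellIso_bijective hP b
    refine ⟨fun x y hxy => ?_, fun ⟨⟨y, x⟩, hyx⟩ => ?_⟩
    · have hl := (hb _).1 (congrArg (fun c => c.1.1) hxy)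
      have hr := (hb _).1 (congrArg (fun c => c.1.2) hxy)
      exact (existsUnique_comp hP b h _ _ (src_compLeft hP b h y)).unique ⟨hl, hr⟩ ⟨rfl, rfl⟩
    · obtain ⟨y, rfl⟩ := (hb _).2 y
      obtain ⟨x, rfl⟩ := (hb _).2 x
      have hyx' : src h y = tgt h x := by
        apply (hb _).1
        exact (mapCell_src (cellIso hP b).hom h y).trans
          (hyx.trans (mapCell_tgt (cellIso hP b).hom h x).symm)
      exact ⟨compOp hP b h y x hyx', Subtype.ext (Prod.ext
        (congrArg (mapCell (cellIso hP b).hom) (compLeft_compOp hP b h y x hyx'))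
        (congrArg (mapCell (cellIso hP b).hom) (compRight_compOp hP b h y x hyx')))⟩
  | rev b hn h =>
    exact (mapCell_cellIso_bijective hP b _).comp
      (Function.bijective_iff_existsUnique _ |>.2 (existsUnique_rev hP b hn h))
  | proj m => exact Function.bijective_iff_existsUnique _ |>.2 (existsUnique_proj hP)
  | bracket m =>
    refine ⟨fun x y hxy => ?_, fun ⟨⟨c₁, c₀⟩, hpar, hπ⟩ => ?_⟩
    · exact (existsUnique_bracketOp hP _ _ (parallel_bracket hP y) (projCell_bracket hP y)).unique
        ⟨congrArg (fun c => c.1.1) hxy, congrArg (fun c => c.1.2) hxy⟩ ⟨rfl, rfl⟩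
    · exact ⟨bracketOp hP c₁ c₀ hpar hπ, Subtype.ext (Prod.ext
        (bracketTgt_bracketOp hP c₁ c₀ hpar hπ) (bracketSrc_bracketOp hP c₁ c₀ hpar hπ))⟩

instance : IsIso (toNerve hP) := by
  rw [NatTrans.isIso_iff_isIso_app]
  intro X
  cases X with
  | cell b e => exact inferInstanceAs (IsIso ((cellIso hP b).hom.app e))
  | oper r => exact (isIso_iff_bijective _).2 (toDom_bijective hP r)

end Model

/-! ### Stretchings are equivalent to models; consequences for the forgetful functor -/

/-- The nerve of a stretching as a model of the theory of stretchings. -/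
noncomputable def stretchingModel (n : ℕ) :
    Stretching.{u} n ⥤ (theoryModels (stretchingTheory.{u} n)).FullSubcategory :=
  ObjectProperty.lift _ (stretchingNerve n) (fun E _ hS => hS E)

instance (n : ℕ) : (stretchingModel.{u} n).Full :=
  Functor.Full.of_comp_faithful_iso (ObjectProperty.liftCompιIso _ (stretchingNerve n) _)

instance (n : ℕ) : (stretchingModel.{u} n).Faithful :=
  Functor.Faithful.of_comp_iso (ObjectProperty.liftCompιIso _ (stretchingNerve n) _)

instance (n : ℕ) : (stretchingModel.{u} n).EssSurj where
  mem_essImage P := ⟨Model.stretching P.property,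
    ⟨ObjectProperty.isoMk _ (asIso (Model.toNerve P.property)).symm⟩⟩

instance (n : ℕ) : (stretchingModel.{u} n).IsEquivalence where

theorem isCardinalLocallyPresentable_stretching (n : ℕ) :
    IsCardinalLocallyPresentable (Stretching.{u} n) Cardinal.aleph0.{u} :=
  have := isCardinalLocallyPresentable_theoryModels (stretchingTheory.{u} n)
  Equivalence.isCardinalLocallyPresentable (stretchingModel n).asEquivalence.symm _

/-- The forgetful functor of stretchings reads off the cells on one side of the nerve. -/
noncomputable def stretchingForgetIso (n : ℕ) :
    stretchingForget.{u} n ≅ stretchingModel n ⋙ (theoryModels (stretchingTheory.{u} n)).ι ⋙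
      (Functor.whiskeringLeft _ _ (Type u)).obj (Shape.incl (n := n) false) :=
  Iso.refl _

/-- The functor is an equivalence, then a reflective inclusion, then restriction along `Shape.incl
false`, whose left adjoint is left Kan extension. -/
theorem isRightAdjoint_stretchingForget (n : ℕ) : (stretchingForget.{u} n).IsRightAdjoint :=
  have := isRightAdjoint_theoryModels_ι (stretchingTheory.{u} n)
  have : ((Functor.whiskeringLeft _ _ (Type u)).obj
      (Shape.incl (n := n) false)).IsRightAdjoint :=
    ((Shape.incl (n := n) false).lanAdjunction (Type u)).isRightAdjoint
  Functor.isRightAdjoint_of_iso (stretchingForgetIso n).symm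

/-- In the same factorization, the equivalence and the restriction preserve all colimits and the
inclusion preserves filtered ones. -/
theorem preservesFilteredColimitsOfSize_stretchingForget (n : ℕ) :
    PreservesFilteredColimitsOfSize.{u, u} (stretchingForget.{u} n) := by
  have h := isCardinalAccessible_theoryModels_ι (stretchingTheory.{u} n)
  have := Functor.IsFinitelyAccessible_iff_preservesFilteredColimitsOfSize.1 h
  refine ⟨fun J _ _ => ?_⟩
  exact preservesColimitsOfShape_of_natIso (stretchingForgetIso n).symm

end InftyN

namespace CategoryTheory

universe v₁ u₁ v₂ u₂

/-! ### Morphisms out of objects that are canonical colimits -/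

namespace DenseFunctor

section

variable {J : Type u₂} [Category.{v₂} J] {C : Type u₁} [Category.{v₁} C] (ι : J ⥤ C)

/-- The canonical cocone of a functor at an object. -/
def cocone (A : C) : Cocone (CostructuredArrow.proj ι A ⋙ ι) where
  pt := A
  ι :=
    { app := fun x => x.hom
      naturality := fun _ _ f => (CostructuredArrow.w f).trans (Category.comp_id _).symm }

variable [ι.IsDense]

/-- The canonical cocones of a dense functor are colimit cocones. -/
noncomputable def isColimitCocone (A : C) : IsColimit (cocone ι A) :=
  IsColimit.ofIsoColimit (ι.denseAt A) (Cocone.ext (Iso.refl _) fun x =>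
    (Category.comp_id _).trans (Category.id_comp x.hom))

variable {ι}

theorem hom_ext {A B : C} {f g : A ⟶ B} (h : ∀ (X : J) (x : ι.obj X ⟶ A), x ≫ f = x ≫ g) :
    f = g :=
  (isColimitCocone ι A).hom_ext fun x => h x.left x.hom

theorem exists_desc {A B : C} (f : ∀ X : J, (ι.obj X ⟶ A) → (ι.obj X ⟶ B))
    (hf : ∀ {X Y : J} (w : X ⟶ Y) (y : ι.obj Y ⟶ A), f X (ι.map w ≫ y) = ι.map w ≫ f Y y) :
    ∃ g : A ⟶ B, ∀ (X : J) (x : ι.obj X ⟶ A), x ≫ g = f X x := by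
  let c : Cocone (CostructuredArrow.proj ι A ⋙ ι) :=
    { pt := B
      ι :=
        { app := fun x => f x.left x.hom
          naturality := fun x y w => by
            have := hf w.left y.hom
            rw [CostructuredArrow.w] at this
            exact this.symm.trans (Category.comp_id _).symm } }
  exact ⟨(isColimitCocone ι A).desc c, fun X x =>
    (isColimitCocone ι A).fac c (CostructuredArrow.mk x)⟩

end

variable {J : Type u} [SmallCategory J] {C : Type u₁} [Category.{u} C] {ι : J ⥤ C} [ι.IsDense]
  [∀ A : C, IsFiltered (CostructuredArrow ι A)] (F : C ⥤ C)
  [PreservesFilteredColimitsOfSize.{u, u} F] {Z A : C} [IsFinitelyPresentable.{u} Z]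

/-- `A` is the filtered colimit of its canonical diagram and `F` preserves it, so a morphism from
the finitely presentable `Z` factors through a stage. The next lemma is the matching statement on
equality of two factorizations. -/
theorem exists_factor (f : Z ⟶ F.obj A) :
    ∃ (X : J) (φ : Z ⟶ F.obj (ι.obj X)) (x : ι.obj X ⟶ A), φ ≫ F.map x = f := by
  obtain ⟨x, φ, h⟩ := IsFinitelyPresentable.exists_hom_of_isColimit
    (isColimitOfPreserves F (isColimitCocone ι A)) f
  exact ⟨x.left, φ, x.hom, h⟩

theorem exists_eq {X X' : J} (φ : Z ⟶ F.obj (ι.obj X)) (φ' : Z ⟶ F.obj (ι.obj X'))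
    (x : ι.obj X ⟶ A) (x' : ι.obj X' ⟶ A) (h : φ ≫ F.map x = φ' ≫ F.map x') :
    ∃ (Y : J) (w : X ⟶ Y) (w' : X' ⟶ Y) (y : ι.obj Y ⟶ A), ι.map w ≫ y = x ∧ ι.map w' ≫ y = x' ∧
      φ ≫ F.map (ι.map w) = φ' ≫ F.map (ι.map w') := by
  obtain ⟨y, w, w', e⟩ := IsFinitelyPresentable.exists_eq_of_isColimit
    (isColimitOfPreserves F (isColimitCocone ι A)) (i := CostructuredArrow.mk x)
    (j := CostructuredArrow.mk x') φ φ' h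
  exact ⟨y.left, w.left, w'.left, y.hom, CostructuredArrow.w w, CostructuredArrow.w w', e⟩

end DenseFunctor

/-! ### Algebras of a finitary monad as presheaves -/

/-- The objects of a category over `C`, seen as free algebras of a monad on `C`. -/
structure FreeIndex {J : Type u} [SmallCategory J] {C : Type u₁} [Category.{u} C] (T : Monad C)
    (ι : J ⥤ C) : Type u where
  of : J

namespace FreeIndex

variable {J : Type u} [SmallCategory J] {C : Type u₁} [Category.{u} C] {T : Monad C} {ι : J ⥤ C}

/-- Morphisms of free algebras, as Kleisli morphisms. -/
@[ext]
structure Hom (X Y : FreeIndex T ι) : Type u where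
  hom : ι.obj X.of ⟶ T.obj (ι.obj Y.of)

@[simps]
instance : SmallCategory (FreeIndex T ι) where
  Hom := Hom
  id X := ⟨T.η.app _⟩
  comp f g := ⟨f.hom ≫ T.map g.hom ≫ T.μ.app _⟩
  id_comp f := by
    ext
    simp [← T.η.naturality_assoc]
  comp_id f := by
    ext
    simp
  assoc f g h := by
    ext
    simp [T.assoc, ← T.μ.naturality_assoc]

@[ext]
theorem hom_ext {X Y : FreeIndex T ι} {f g : X ⟶ Y} (h : f.hom = g.hom) : f = g :=
  Hom.ext h

variable (T ι)

/-- The free algebra functor. -/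
@[simps]
def free : J ⥤ FreeIndex T ι where
  obj X := ⟨X⟩
  map f := ⟨ι.map f ≫ T.η.app _⟩
  map_id X := by
    ext
    simp
  map_comp f g := by
    ext
    simpa using congrArg (ι.map f ≫ ·) (T.η.naturality (ι.map g))

/-- The nerve of an algebra. -/
@[simps]
def nerve : T.Algebra ⥤ (FreeIndex T ι)ᵒᵖ ⥤ Type u where
  obj A :=
    { obj := fun X => ι.obj X.unop.of ⟶ A.A
      map := fun φ => ↾(fun x => φ.unop.hom ≫ T.map x ≫ A.a)
      map_id := fun X => by
        ext x
        simp [← T.η.naturality_assoc, A.unit]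
      map_comp := fun φ ψ => by
        ext x
        simp [A.assoc, ← T.μ.naturality_assoc] }
  map f :=
    { app := fun X => ↾(fun x => x ≫ f.f)
      naturality := fun X Y φ => by
        ext x
        simp [f.h] }
  map_id A := by
    ext
    simp
  map_comp f g := by
    ext
    simp

theorem eta_map_comp {T : Monad C} {A : T.Algebra} {X : C} (x : X ⟶ A.A) :
    T.η.app X ≫ T.map x ≫ A.a = x := by
  simp [← T.η.naturality_assoc, A.unit]

theorem nerve_map_free {X Y : J} (f : X ⟶ Y) (B : T.Algebra) (x : ι.obj Y ⟶ B.A) :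
    ((nerve T ι).obj B).map ((free T ι).map f).op x = ι.map f ≫ x :=
  (Category.assoc _ _ _).trans (congrArg _ (eta_map_comp x))

section

variable [ι.IsDense]

instance : (nerve T ι).Faithful where
  map_injective {A B} f g h := by
    ext
    exact DenseFunctor.hom_ext (ι := ι) fun X x => congrArg (fun τ : (nerve T ι).obj A ⟶ _ => τ.app (op ⟨X⟩) x) h

variable [∀ A : C, IsFiltered (CostructuredArrow ι A)]
  [PreservesFilteredColimitsOfSize.{u, u} T.toFunctor]
  [∀ X : J, IsFinitelyPresentable.{u} (ι.obj X)]

/-- Density turns a natural transformation into a morphism `h` of underlying objects. Compatibility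
of `h` with the structure maps is an equation between morphisms out of `T A`; it is tested on `φ ≫
T.map x`, where it is naturality at the Kleisli morphism `φ`. -/
instance : (nerve T ι).Full where
  map_surjective {A B} τ := by
    have hτ : ∀ {X Y : J} (φ : ι.obj X ⟶ T.obj (ι.obj Y)) (y : ι.obj Y ⟶ A.A),
        τ.app (op ⟨X⟩) (φ ≫ T.map y ≫ A.a) = φ ≫ T.map (τ.app (op ⟨Y⟩) y) ≫ B.a :=
      fun {X Y} φ y => NatTrans.naturality_apply τ
        (Quiver.Hom.op (⟨φ⟩ : (⟨X⟩ : FreeIndex T ι) ⟶ ⟨Y⟩)) y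
    obtain ⟨h, hh⟩ := DenseFunctor.exists_desc (ι := ι) (A := A.A) (B := B.A)
      (fun X x => τ.app (op ⟨X⟩) x) (fun {X Y} w y => by
        exact (congrArg _ (nerve_map_free T ι w A y).symm).trans
          ((NatTrans.naturality_apply τ _ y).trans (nerve_map_free T ι w B _)))
    refine ⟨⟨h, DenseFunctor.hom_ext (ι := ι) fun Z f => ?_⟩, ?_⟩
    · obtain ⟨X, φ, x, rfl⟩ := DenseFunctor.exists_factor (ι := ι) T.toFunctor f
      have := hτ φ x
      rw [← hh, ← hh] at this
      simpa using! this.symm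
    · ext X x
      exact hh _ x

variable {T ι}

/-- Kleisli morphisms act, through `σ`, on the morphisms from objects of `J` to `A`. Every `f :
ι.obj X ⟶ T.obj A` has the form `φ ≫ T.map y`, and sending it to the action of `φ` on `y` defines
the structure map `T A ⟶ A` by density. The algebra laws are the functoriality of `P`. -/
theorem mem_essImage_nerve (P : (FreeIndex T ι)ᵒᵖ ⥤ Type u) (A : C)
    (σ : ∀ X : J, P.obj (op ⟨X⟩) ≃ (ι.obj X ⟶ A))
    (hσ : ∀ {X Y : J} (w : X ⟶ Y) (p : P.obj (op ⟨Y⟩)),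
      σ X (P.map ((free T ι).map w).op p) = ι.map w ≫ σ Y p) :
    (nerve T ι).essImage P := by
  let act : ∀ {X Y : J}, (ι.obj X ⟶ T.obj (ι.obj Y)) → (ι.obj Y ⟶ A) → (ι.obj X ⟶ A) :=
    fun {X Y} φ y => σ X (P.map (Quiver.Hom.op (⟨φ⟩ : (⟨X⟩ : FreeIndex T ι) ⟶ ⟨Y⟩))
      ((σ Y).symm y))
  have act_free : ∀ {X Y : J} (w : X ⟶ Y) (y : ι.obj Y ⟶ A),
      act (ι.map w ≫ T.η.app _) y = ι.map w ≫ y := fun w y => by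
    refine (hσ w _).trans ?_
    simp
  have act_comp : ∀ {X Y Z : J} (φ : ι.obj X ⟶ T.obj (ι.obj Y)) (ψ : ι.obj Y ⟶ T.obj (ι.obj Z))
      (z : ι.obj Z ⟶ A), act (φ ≫ T.map ψ ≫ T.μ.app _) z = act φ (act ψ z) :=
    fun {X Y Z} φ ψ z => by
      simp only [act, Equiv.symm_apply_apply]
      exact congrArg _ (Functor.map_comp_apply P
        (Quiver.Hom.op (⟨ψ⟩ : (⟨Y⟩ : FreeIndex T ι) ⟶ ⟨Z⟩))
        (Quiver.Hom.op (⟨φ⟩ : (⟨X⟩ : FreeIndex T ι) ⟶ ⟨Y⟩)) _)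
  have act_map : ∀ {X Y Z : J} (φ : ι.obj X ⟶ T.obj (ι.obj Y)) (w : Y ⟶ Z) (z : ι.obj Z ⟶ A),
      act (φ ≫ T.map (ι.map w)) z = act φ (ι.map w ≫ z) := fun φ w z => by
    rw [← act_free, ← act_comp]
    simp
  have map_act : ∀ {X Y Z : J} (w : X ⟶ Y) (φ : ι.obj Y ⟶ T.obj (ι.obj Z)) (z : ι.obj Z ⟶ A),
      act (ι.map w ≫ φ) z = ι.map w ≫ act φ z := fun w φ z => by
    rw [← act_free, ← act_comp]
    simp [← T.η.naturality_assoc]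
  have act_unit : ∀ {X : J} (x : ι.obj X ⟶ A), act (T.η.app _) x = x := fun {X} x => by
    simpa using act_free (𝟙 X) x
  -- Independence of the factorization: two factorizations of the same morphism already agree at a
  -- later stage of the canonical diagram.
  have act_eq : ∀ {X Y Y' : J} (φ : ι.obj X ⟶ T.obj (ι.obj Y)) (φ' : ι.obj X ⟶ T.obj (ι.obj Y'))
      (y : ι.obj Y ⟶ A) (y' : ι.obj Y' ⟶ A), φ ≫ T.map y = φ' ≫ T.map y' →
      act φ y = act φ' y' := fun {X Y Y'} φ φ' y y' h => by
    obtain ⟨Z, w, w', z, rfl, rfl, e⟩ := DenseFunctor.exists_eq T.toFunctor φ φ' y y' h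
    rw [← act_map, ← act_map, e]
  choose Y φ y hφ using fun (X : J) (f : ι.obj X ⟶ T.obj A) =>
    DenseFunctor.exists_factor (ι := ι) T.toFunctor f
  obtain ⟨a, ha⟩ := DenseFunctor.exists_desc (ι := ι) (A := T.obj A) (B := A)
    (fun X f => act (φ X f) (y X f)) (fun w f => by
      rw [← map_act]
      exact act_eq _ _ _ _ (by rw [hφ, Category.assoc, hφ]))
  have ha' : ∀ {X Y : J} (φ : ι.obj X ⟶ T.obj (ι.obj Y)) (y : ι.obj Y ⟶ A),
      φ ≫ T.map y ≫ a = act φ y := fun φ y => by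
    rw [← Category.assoc, ha]
    exact act_eq _ _ _ _ (hφ _ _)
  let B : T.Algebra :=
    { A := A
      a := a
      unit := DenseFunctor.hom_ext (ι := ι) fun X x => by
        have := ha' (T.η.app _) x
        rw [act_unit] at this
        simpa [← T.η.naturality_assoc] using this
      assoc := DenseFunctor.hom_ext (ι := ι) fun Z f => by
        -- Factoring twice reduces associativity on `T (T A)` to `act_comp` for two composable
        -- Kleisli morphisms.
        obtain ⟨Y, φ, y, rfl⟩ := DenseFunctor.exists_factor (ι := ι) T.toFunctor f
        obtain ⟨X, ψ, x, rfl⟩ := DenseFunctor.exists_factor (ι := ι) T.toFunctor y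
        have h₁ := ha' (φ ≫ T.map ψ ≫ T.μ.app _) x
        have h₂ := ha' φ ((ψ ≫ T.map x) ≫ a)
        rw [act_comp, ← ha' ψ, ← ha' φ] at h₁
        simpa [← T.μ.naturality_assoc] using h₁ }
  exact ⟨B, ⟨NatIso.ofComponents (fun X => (σ X.unop.of).symm.toIso) (fun {X Y} f => by
    ext x
    exact (congrArg (σ Y.unop.of).symm (ha' f.unop.hom x)).trans
      ((σ Y.unop.of).symm_apply_apply _))⟩⟩

end

end FreeIndex

/-! ### Finitary monads on presheaf categories -/

section

variable {G : Type} [SmallCategory G] {J : Type u} [SmallCategory J] (y : G ⥤ J)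

/-- The presheaves represented by the objects of `J` on a category over `J`. -/
def relativeYoneda : J ⥤ Gᵒᵖ ⥤ Type u :=
  yoneda ⋙ (Functor.whiskeringLeft _ _ _).obj y.op

namespace FreeIndex

theorem map_free_comp {C : Type u₁} [Category.{u} C] {T : Monad C} {ι : J ⥤ C}
    (P : (FreeIndex T ι)ᵒᵖ ⥤ Type u) {X Y Z : J} (f : X ⟶ Y) (g : Y ⟶ Z) (p : P.obj (op ⟨Z⟩)) :
    P.map ((free T ι).map (f ≫ g)).op p =
      P.map ((free T ι).map f).op (P.map ((free T ι).map g).op p) := by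
  rw [Functor.map_comp, op_comp]
  exact Functor.map_comp_apply P _ _ p

variable (T : Monad (Gᵒᵖ ⥤ Type u))

/-- Presheaves on the free algebras, restricted to `G`. -/
abbrev restriction : ((FreeIndex T (relativeYoneda y))ᵒᵖ ⥤ Type u) ⥤ Gᵒᵖ ⥤ Type u :=
  (Functor.whiskeringLeft _ _ _).obj (y ⋙ free T (relativeYoneda y)).op

/-- The comparison of a presheaf on free algebras with the nerve of its restriction. -/
def comparison (X : J) :
    (evaluation _ (Type u)).obj (op (⟨X⟩ : FreeIndex T (relativeYoneda y))) ⟶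
      restriction y T ⋙ coyoneda.obj (op ((relativeYoneda y).obj X)) where
  app P := ↾(fun p =>
    { app := fun e => ↾(fun f : y.obj e.unop ⟶ X =>
        P.map ((free T (relativeYoneda y)).map f).op p)
      naturality := fun e e' g => by
        ext f
        exact map_free_comp P (y.map g.unop) f p })
  naturality P Q τ := by
    ext p
    apply NatTrans.ext
    funext e
    ext f
    exact (NatTrans.naturality_apply τ _ p).symm

variable [(relativeYoneda y).IsDense] [(y ⋙ relativeYoneda y).IsDense]
  [∀ A : Gᵒᵖ ⥤ Type u, IsFiltered (CostructuredArrow (relativeYoneda y) A)]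
  [PreservesFilteredColimitsOfSize.{u, u} T.toFunctor]
  [∀ X : J, IsFinitelyPresentable.{u} ((relativeYoneda y).obj X)]

-- Since `relativeYoneda y` is fully faithful, a map from its value at `X` into the restricted nerve
-- is a compatible family of maps to `B.A`, indexed by the maps from the objects coming from `G`.
-- Density of these objects glues the family to a unique map.
omit [(relativeYoneda y).IsDense]
  [∀ A : Gᵒᵖ ⥤ Type u, IsFiltered (CostructuredArrow (relativeYoneda y) A)]
  [PreservesFilteredColimitsOfSize.{u, u} T.toFunctor]
  [∀ X : J, IsFinitelyPresentable.{u} ((relativeYoneda y).obj X)] in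
theorem comparison_nerve_bijective [(relativeYoneda y).Full] [(relativeYoneda y).Faithful] (X : J)
    (B : T.Algebra) : Function.Bijective
      ((comparison y T X).app ((nerve T (relativeYoneda y)).obj B)) := by
  have key : ∀ (x : (relativeYoneda y).obj X ⟶ B.A) {e : Gᵒᵖ} (f : y.obj e.unop ⟶ X),
      ((comparison y T X).app ((nerve T (relativeYoneda y)).obj B) x).app e f =
        (relativeYoneda y).map f ≫ x := fun x e f =>
    nerve_map_free T _ f B x
  constructor
  · intro x x' h
    refine DenseFunctor.hom_ext (ι := y ⋙ relativeYoneda y) fun e k => ?_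
    obtain ⟨f, rfl⟩ := (relativeYoneda y).map_surjective k
    exact (key x (e := op e) f).symm.trans
      ((congrArg (fun τ => τ.app (op e) f) h).trans (key x' (e := op e) f))
  · intro τ
    have hτ : ∀ {e e' : G} (g : e ⟶ e') (f : y.obj e' ⟶ X), τ.app (op e) (y.map g ≫ f) =
        (relativeYoneda y).map (y.map g) ≫ τ.app (op e') f := fun {e e'} g f =>
      (NatTrans.naturality_apply τ g.op f).trans
        (nerve_map_free T (relativeYoneda y) (y.map g) B _)
    obtain ⟨x, hx⟩ := DenseFunctor.exists_desc (ι := y ⋙ relativeYoneda y)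
      (A := (relativeYoneda y).obj X) (B := B.A)
      (fun e k => τ.app (op e) ((relativeYoneda y).preimage k)) (fun {e e'} g k => by
        obtain ⟨f, rfl⟩ := (relativeYoneda y).map_surjective k
        rw [Functor.comp_map, ← Functor.map_comp, Functor.preimage_map, Functor.preimage_map]
        exact hτ g f)
    refine ⟨x, ?_⟩
    apply NatTrans.ext
    funext e
    ext f
    refine (key x f).trans ((hx e.unop ((relativeYoneda y).map f)).trans ?_)
    exact congrArg (τ.app e) ((relativeYoneda y).preimage_map (show y.obj e.unop ⟶ X from f))

/-- Bijectivity of the comparison is invariant under isomorphism and holds for nerves. Conversely,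
bijective comparisons are the identifications `σ` required by `mem_essImage_nerve`, with the
restriction of `P` to `G` as underlying presheaf. -/
theorem essImage_nerve_eq [(relativeYoneda y).Full] [(relativeYoneda y).Faithful] :
    (nerve T (relativeYoneda y)).essImage = bijectiveObjects (comparison y T) := by
  ext P
  constructor
  · rintro ⟨B, ⟨e⟩⟩ X
    have h := (comparison y T X).naturality e.hom
    rw [← isIso_iff_bijective]
    have : IsIso ((comparison y T X).app ((nerve T (relativeYoneda y)).obj B)) :=
      (isIso_iff_bijective _).2 (comparison_nerve_bijective y T X B)
    have : (comparison y T X).app P = ((evaluation _ (Type u)).obj _).map e.inv ≫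
        (comparison y T X).app _ ≫ (restriction y T ⋙ coyoneda.obj _).map e.hom := by
      rw [← NatTrans.naturality, ← Functor.map_comp_assoc, e.inv_hom_id, Functor.map_id,
        Category.id_comp]
    rw [this]
    infer_instance
  · intro hP
    refine mem_essImage_nerve P ((restriction y T).obj P)
      (fun X => Equiv.ofBijective _ (hP X)) (fun {X Y} w p => ?_)
    apply NatTrans.ext
    funext e
    ext f
    exact (map_free_comp P f w p).symm

theorem isCardinalLocallyPresentable_algebra_of_relativeYoneda [(relativeYoneda y).Full]
    [(relativeYoneda y).Faithful] :
    IsCardinalLocallyPresentable T.Algebra Cardinal.aleph0.{u} := by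
  have : ((Functor.whiskeringLeft _ _ (Type u)).obj
      (y ⋙ free T (relativeYoneda y)).op).IsRightAdjoint :=
    ((y ⋙ free T (relativeYoneda y)).op.lanAdjunction (Type u)).isRightAdjoint
  have h := isCardinalLocallyPresentable_bijectiveObjects (comparison y T)
    (fun X =>
      have : ((evaluation _ (Type u)).obj
          (op (⟨X⟩ : FreeIndex T (relativeYoneda y)))).IsRightAdjoint :=
        (evaluationAdjunctionRight (Type u) _).isRightAdjoint
      .of_isRightAdjoint _)
    (fun X => .comp_coyoneda (restriction y T) ((relativeYoneda y).obj X))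
  rw [← essImage_nerve_eq] at h
  exact Equivalence.isCardinalLocallyPresentable
    (nerve T (relativeYoneda y)).toEssImage.asEquivalence.symm _

end FreeIndex

/-- Full faithfulness, then `δ`, then Yoneda: maps `y.obj e ⟶ X` are maps from the presheaf
represented by `e` to `ι.obj X`, that is, elements of `ι.obj X` at `e`. -/
theorem uliftYonedaEquiv_inv_comp_bijective (ι : J ⥤ Gᵒᵖ ⥤ Type u) [ι.Full] [ι.Faithful]
    (δ : y ⋙ ι ≅ uliftYoneda.{u}) (X : J) (e : G) :
    Function.Bijective (fun f : y.obj e ⟶ X => uliftYonedaEquiv (δ.inv.app e ≫ ι.map f)) :=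
  uliftYonedaEquiv.bijective.comp
    ((Iso.homCongr (δ.app e) (Iso.refl (ι.obj X))).bijective.comp
      ((Functor.FullyFaithful.ofFullyFaithful ι).map_bijective _ _))

/-- The presheaves represented by the objects of a full subcategory of presheaves. -/
noncomputable def relativeYonedaIso (ι : J ⥤ Gᵒᵖ ⥤ Type u) [ι.Full] [ι.Faithful]
    (δ : y ⋙ ι ≅ uliftYoneda.{u}) : relativeYoneda y ≅ ι :=
  NatIso.ofComponents (fun X => NatIso.ofComponents (fun e =>
    (Equiv.ofBijective _ (uliftYonedaEquiv_inv_comp_bijective y ι δ X e.unop)).toIso)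
      (fun {e e'} g => by
        ext f
        have hδ : δ.inv.app e'.unop ≫ ι.map (y.map g.unop) =
            uliftYoneda.map g.unop ≫ δ.inv.app e.unop := (δ.inv.naturality g.unop).symm
        have h₁ : δ.inv.app e'.unop ≫ ι.map (y.map g.unop ≫ (show y.obj e.unop ⟶ X from f)) =
            uliftYoneda.map g.unop ≫ δ.inv.app e.unop ≫ ι.map (show y.obj e.unop ⟶ X from f) := by
          rw [Functor.map_comp, ← Category.assoc, hδ, Category.assoc]
        have h₂ := uliftYonedaEquiv_naturality.{u} (X := e)
          (δ.inv.app e.unop ≫ ι.map (show y.obj e.unop ⟶ X from f)) g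
        exact (congrArg uliftYonedaEquiv.{u} h₁).trans h₂.symm))
    (fun {X Y} w => by
      apply NatTrans.ext
      funext e
      ext f
      exact congrArg uliftYonedaEquiv ((congrArg (δ.inv.app e.unop ≫ ·)
        (ι.map_comp (show y.obj e.unop ⟶ X from f) w)).trans (Category.assoc _ _ _).symm))

end

/-- `J` is a small model of all finitely presentable presheaves: it contains the representables, is
dense, and has filtered comma categories. Its inclusion is replaced by the isomorphic
`relativeYoneda y`, for which `comparison` has an explicit formula. -/
theorem isCardinalLocallyPresentable_algebra {G : Type} [SmallCategory G]
    (T : Monad (Gᵒᵖ ⥤ Type u)) [PreservesFilteredColimitsOfSize.{u, u} T.toFunctor] :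
    IsCardinalLocallyPresentable T.Algebra Cardinal.aleph0.{u} := by
  let Q := ObjectProperty.isFinitelyPresentable.{u} (Gᵒᵖ ⥤ Type u)
  let E := equivSmallModel.{u} Q.FullSubcategory
  let ι := E.inverse ⋙ Q.ι
  let z : G ⥤ Q.FullSubcategory := Q.lift uliftYoneda.{u} (fun e =>
    inferInstanceAs (IsCardinalPresentable (uliftYoneda.{u}.obj e) Cardinal.aleph0.{u}))
  let y : G ⥤ SmallModel Q.FullSubcategory := z ⋙ E.functor
  let δ : y ⋙ ι ≅ uliftYoneda.{u} := Functor.isoWhiskerLeft z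
    (Functor.isoWhiskerRight E.unitIso.symm Q.ι)
  let ω := relativeYonedaIso y ι δ
  have : (relativeYoneda y).Full := Functor.Full.of_iso ω.symm
  have : (relativeYoneda y).Faithful := Functor.Faithful.of_iso ω.symm
  have : ι.IsDense := inferInstanceAs (E.inverse ⋙ Q.ι).IsDense
  have : (relativeYoneda y).IsDense := .of_iso ω.symm
  have : (y ⋙ relativeYoneda y).IsDense :=
    .of_iso (Functor.isoWhiskerLeft y ω ≪≫ δ).symm
  have (A : Gᵒᵖ ⥤ Type u) : IsFiltered (CostructuredArrow (relativeYoneda y) A) := by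
    have : IsFiltered (CostructuredArrow Q.ι A) := inferInstance
    have : IsFiltered (CostructuredArrow ι A) :=
      .of_equivalence (CostructuredArrow.pre E.inverse Q.ι A).asEquivalence.symm
    exact .of_equivalence (CostructuredArrow.mapNatIso ω).symm
  have (X : SmallModel Q.FullSubcategory) :
      IsFinitelyPresentable.{u} ((relativeYoneda y).obj X) :=
    have : IsFinitelyPresentable.{u} (ι.obj X) := (E.inverse.obj X).property
    isCardinalPresentable_of_iso (ω.app X).symm _
  exact FreeIndex.isCardinalLocallyPresentable_algebra_of_relativeYoneda y T

end CategoryTheory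

theorem mainTheorem3 (n : ℕ) :
    IsLocallyPresentable.{u} (InftyN.Stretching.{u} n) ∧
    (InftyN.stretchingForget.{u} n).IsRightAdjoint ∧
    ∀ (F : InftyN.InfGraph.{u} ⥤ InftyN.Stretching.{u} n)
      (adj : F ⊣ InftyN.stretchingForget.{u} n),
      PreservesFilteredColimitsOfSize.{u, u} adj.toMonad.toFunctor ∧
      IsLocallyPresentable.{u} adj.toMonad.Algebra := by
  have hE := InftyN.isCardinalLocallyPresentable_stretching.{u} n
  refine ⟨⟨_, inferInstance, hE⟩, InftyN.isRightAdjoint_stretchingForget n, fun F adj => ?_⟩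
  have := InftyN.preservesFilteredColimitsOfSize_stretchingForget.{u} n
  have := adj.leftAdjoint_preservesColimits
  -- The left adjoint `F` preserves all colimits and the forgetful functor preserves filtered ones.
  have : PreservesFilteredColimitsOfSize.{u, u} adj.toMonad.toFunctor :=
    ⟨fun J _ _ => inferInstanceAs (PreservesColimitsOfShape J
      (F ⋙ InftyN.stretchingForget.{u} n))⟩
  exact ⟨this, _, inferInstance, isCardinalLocallyPresentable_algebra adj.toMonad⟩
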